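/- Modules are right modules. For a graded ring $R=\bigoplus_{i\in\mathbb Z}R_i$ let $\mathrm{Mod}^{\mathbb Z}R$ be the category of $\mathbb Z$-graded right $R$-modules and degree-preserving homomorphisms, and write $M\in\mathrm{Mod}^{\le n}R$ (resp. $M\in\mathrm{Mod}^{\ge n}R$) if $M_j=0$ for all $j>n$ (resp. for all $j<n$). We call $R$ negatively graded if $R_i=0$ for all $i>0$. (1) Let $R$ be a negatively graded algebra over a field $k$ such that (R1) each $R_i$ is finite dimensional over $k$; (R2) every graded right $R$-module $M$ of finite length has finite projective dimension, in the sense that it admits a finite resolution $0\to P_n\to\cdots\to P_0\to M\to 0$ by finitely generated graded projective modules. Let $\mathrm{per}^{\mathbb Z}R$ be the thick subcategory of $\mathcal D(\mathrm{Mod}^{\mathbb Z}R)$ generated by the finitely generated graded projective modules. Then $$t^{\le 0}=\{X\in\mathrm{per}^{\mathbb Z}R \mid H^i(X)\in\mathrm{Mod}^{\le -i}R\ \text{for all } i\in\mathbb Z\},\qquad t^{\ge 0}=\{X\in\mathrm{per}^{\mathbb Z}R \mid H^i(X)\in\mathrm{Mod}^{\ge -i}R\ \text{for all } i\in\mathbb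 Z\}$$ form a $t$-structure $(t^{\le 0},t^{\ge 0})$ on $\mathrm{per}^{\mathbb Z}R$. (2) Let $R$ be a negatively graded ring which is graded right coherent (every finitely generated homogeneous right ideal is finitely presented), so that the category $\mathrm{mod}^{\mathbb Z}R$ of finitely presented graded right $R$-modules is abelian. Assume moreover (R3) for each $i\le 0$ the truncation $R_{>i}=R/R_{\le i}$, where $R_{\le i}=\bigoplus_{j\le i}R_j$, is finitely presented as a right $R$-module. Then $$t^{\le 0}=\{X\in\mathcal D^b(\mathrm{mod}^{\mathbb Z}R) \mid H^i(X)\in\mathrm{Mod}^{\le -i}R\ \text{for all } i\in\mathbb Z\},\qquad t^{\ge 0}=\{X\in\mathcal D^b(\mathrm{mod}^{\mathbb Z}R) \mid H^i(X)\in\mathrm{Mod}^{\ge -i}R\ \text{for all } i\in\mathbb Z\}$$ form a $t$-structure $(t^{\le 0},t^{\ge 0})$ on $\mathcal D^b(\mathrm{mod}^{\mathbb Z}R)$. -/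

import Mathlib

open CategoryTheory CategoryTheory.Limits CategoryTheory.Triangulated DirectSum

universe w u v

/-! ### Graded right modules -/

/-- A `ℤ`-graded right module over the graded ring `(R, 𝓡)`: a right `R`-module (that is, an
`Rᵐᵒᵖ`-module, `m · r = MulOpposite.op r • m`) which is the internal direct sum of additive
subgroups `piece i` such that `piece j · 𝓡 i ⊆ piece (j + i)`. -/
structure GrMod {R : Type u} [Ring R] {σ : Type*} [SetLike σ R] (𝓡 : ℤ → σ) where
  carrier : Type u
  [addCommGroup : AddCommGroup carrier]
  [module : Module Rᵐᵒᵖ carrier]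
  piece : ℤ → AddSubgroup carrier
  isInternal : DirectSum.IsInternal piece
  smul_mem : ∀ {i j : ℤ} {r : R} {m : carrier}, r ∈ 𝓡 i → m ∈ piece j →
    MulOpposite.op r • m ∈ piece (j + i)

/-- `(R, 𝓡)` is negatively graded: `R = ⨁_{i ≤ 0} R_i`. -/
def IsNegativelyGraded {R : Type u} [Ring R] {σ : Type*} [SetLike σ R] (𝓡 : ℤ → σ) : Prop :=
  ∀ i : ℤ, 0 < i → ∀ r ∈ 𝓡 i, r = 0

namespace GrMod

attribute [instance] GrMod.addCommGroup GrMod.module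

section Basic

variable {R : Type u} [Ring R] {σ : Type*} [SetLike σ R] {𝓡 : ℤ → σ}

instance : CoeSort (GrMod 𝓡) (Type u) := ⟨GrMod.carrier⟩

/-- All homogeneous elements of `M` have degree `≤ n`. -/
def ConcentratedLE (M : GrMod 𝓡) (n : ℤ) : Prop := ∀ j : ℤ, n < j → M.piece j = ⊥

/-- All homogeneous elements of `M` have degree `≥ n`. -/
def ConcentratedGE (M : GrMod 𝓡) (n : ℤ) : Prop := ∀ j : ℤ, j < n → M.piece j = ⊥

/-- Morphisms of graded modules: `R`-linear maps which preserve the degree. -/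
@[ext]
structure Hom (M N : GrMod 𝓡) where
  lin : M →ₗ[Rᵐᵒᵖ] N
  map_mem : ∀ {i : ℤ} {m : M}, m ∈ M.piece i → lin m ∈ N.piece i

instance : Category (GrMod 𝓡) where
  Hom := Hom
  id M := ⟨LinearMap.id, fun h => h⟩
  comp f g := ⟨g.lin ∘ₗ f.lin, fun h => g.map_mem (f.map_mem h)⟩

@[ext]
lemma hom_ext {M N : GrMod 𝓡} {f g : M ⟶ N} (h : ∀ m : M, f.lin m = g.lin m) : f = g :=
  Hom.ext (LinearMap.ext h)

@[simp] lemma id_lin (M : GrMod 𝓡) : Hom.lin (𝟙 M) = LinearMap.id := rfl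

@[simp] lemma comp_lin {M N P : GrMod 𝓡} (f : M ⟶ N) (g : N ⟶ P) :
    (f ≫ g).lin = g.lin ∘ₗ f.lin := rfl

section Additive

variable {M N : GrMod 𝓡}

instance : Zero (M ⟶ N) := ⟨⟨0, fun _ => by simp⟩⟩
instance : Add (M ⟶ N) :=
  ⟨fun f g => ⟨f.lin + g.lin, fun h => add_mem (f.map_mem h) (g.map_mem h)⟩⟩
instance : Neg (M ⟶ N) := ⟨fun f => ⟨-f.lin, fun h => neg_mem (f.map_mem h)⟩⟩
instance : Sub (M ⟶ N) :=
  ⟨fun f g => ⟨f.lin - g.lin, fun h => sub_mem (f.map_mem h) (g.map_mem h)⟩⟩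
instance : SMul ℕ (M ⟶ N) := ⟨fun n f => ⟨n • f.lin, fun h => nsmul_mem (f.map_mem h) n⟩⟩
instance : SMul ℤ (M ⟶ N) := ⟨fun n f => ⟨n • f.lin, fun h => zsmul_mem (f.map_mem h) n⟩⟩

lemma lin_injective : Function.Injective (fun f : M ⟶ N => f.lin) := fun _ _ h => Hom.ext h

instance : AddCommGroup (M ⟶ N) :=
  lin_injective.addCommGroup _ rfl (fun _ _ => rfl) (fun _ => rfl) (fun _ _ => rfl)
    (fun _ _ => rfl) (fun _ _ => rfl)

@[simp] lemma zero_lin : (0 : M ⟶ N).lin = 0 := rfl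
@[simp] lemma add_lin (f g : M ⟶ N) : (f + g).lin = f.lin + g.lin := rfl

end Additive

instance : Preadditive (GrMod 𝓡) where
  add_comp _ _ _ f g h := by ext; simp
  comp_add _ _ _ f g h := by ext; simp

lemma lin_apply_eq_zero {M N P : GrMod 𝓡} {f : M ⟶ N} {g : N ⟶ P} (h : f ≫ g = 0) (m : M) :
    g.lin (f.lin m) = 0 := by
  have := congrArg (fun k : M ⟶ P => k.lin m) h
  simpa using this

/-! ### Homogeneous components -/

/-- The decomposition of a graded module into its homogeneous components. -/
noncomputable def decompEquiv (M : GrMod 𝓡) : (⨁ i, M.piece i) ≃+ M :=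
  AddEquiv.ofBijective (DirectSum.coeAddMonoidHom M.piece) (by exact M.isInternal)

lemma decompEquiv_apply (M : GrMod 𝓡) (d : ⨁ i, M.piece i) :
    M.decompEquiv d = DirectSum.coeAddMonoidHom M.piece d := rfl

/-- The projection of a graded module to its component of degree `i`. -/
noncomputable def proj (M : GrMod 𝓡) (i : ℤ) : M →+ M :=
  ((M.piece i).subtype.comp
    (DFinsupp.evalAddMonoidHom (β := fun i => M.piece i) i)).comp
      M.decompEquiv.symm.toAddMonoidHom

lemma proj_mem (M : GrMod 𝓡) (i : ℤ) (m : M) : M.proj i m ∈ M.piece i := Subtype.property _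

lemma proj_apply (M : GrMod 𝓡) (i : ℤ) (m : M) :
    M.proj i m = (M.decompEquiv.symm m i : M) := rfl

lemma equiv_symm_of_mem (M : GrMod 𝓡) {i : ℤ} {m : M} (hm : m ∈ M.piece i) :
    M.decompEquiv.symm m = DirectSum.of (fun i => M.piece i) i ⟨m, hm⟩ := by
  rw [AddEquiv.symm_apply_eq, decompEquiv_apply, DirectSum.coeAddMonoidHom_of]

lemma proj_same (M : GrMod 𝓡) {i : ℤ} {m : M} (hm : m ∈ M.piece i) : M.proj i m = m := by
  rw [proj_apply, equiv_symm_of_mem M hm, DirectSum.of_eq_same]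

lemma proj_ne (M : GrMod 𝓡) {i j : ℤ} {m : M} (hm : m ∈ M.piece j) (h : j ≠ i) :
    M.proj i m = 0 := by
  rw [proj_apply, equiv_symm_of_mem M hm, DirectSum.of_eq_of_ne _ _ _ h.symm]
  rfl

lemma exists_sum_proj (M : GrMod 𝓡) (m : M) : ∃ s : Finset ℤ, ∑ i ∈ s, M.proj i m = m := by
  classical
  set e := M.decompEquiv
  refine ⟨(e.symm m).support, ?_⟩
  have h : e (e.symm m) = m := e.apply_symm_apply m
  conv_rhs => rw [← h]
  change _ = DirectSum.coeAddMonoidHom M.piece (e.symm m)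
  rw [DirectSum.coeAddMonoidHom_eq_dfinsuppSum]
  rfl

lemma iSup_piece (M : GrMod 𝓡) (m : M) : m ∈ ⨆ i, M.piece i := by
  obtain ⟨s, hs⟩ := M.exists_sum_proj m
  rw [← hs]
  exact sum_mem fun i _ => (le_iSup M.piece i) (M.proj_mem i m)

lemma lin_proj {M N : GrMod 𝓡} (f : M ⟶ N) (i : ℤ) (m : M) :
    f.lin (M.proj i m) = N.proj i (f.lin m) := by
  induction M.iSup_piece m using AddSubgroup.iSup_induction' with
  | hp j x hx =>
    by_cases h : j = i
    · subst h
      rw [M.proj_same hx, N.proj_same (f.map_mem hx)]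
    · rw [M.proj_ne hx h, N.proj_ne (f.map_mem hx) h, map_zero]
  | h1 => simp
  | hadd x y _ _ hx hy => simp [hx, hy]

/-- A criterion for a family of subgroups to be a grading. -/
lemma isInternal_of_proj {A : Type*} [AddCommGroup A] (p : ℤ → AddSubgroup A) (π : ℤ → A →+ A)
    (h_same : ∀ i, ∀ a ∈ p i, π i a = a) (h_ne : ∀ i j, j ≠ i → ∀ a ∈ p j, π i a = 0)
    (h_sup : ∀ a, a ∈ ⨆ i, p i) : DirectSum.IsInternal p := by
  classical
  have key : ∀ (i : ℤ) (d : ⨁ i, p i), π i (DirectSum.coeAddMonoidHom p d) = d i := by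
    intro i d
    induction d using DirectSum.induction_on with
    | zero => simp
    | of j x =>
      rw [DirectSum.coeAddMonoidHom_of]
      by_cases h : j = i
      · subst h
        rw [h_same _ _ x.2, DirectSum.of_eq_same]
      · rw [h_ne i j h _ x.2, DirectSum.of_eq_of_ne _ _ _ (Ne.symm h)]
        rfl
    | add x y hx hy => simp [hx, hy]
  constructor
  · rw [injective_iff_map_eq_zero]
    intro d hd
    ext i
    rw [← key i d, hd]
    simp
  · intro a
    have : (⨆ i, p i) ≤ (DirectSum.coeAddMonoidHom p).range := by
      refine iSup_le fun i x hx => ⟨DirectSum.of (fun i => p i) i ⟨x, hx⟩, ?_⟩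
      simp
    exact this (h_sup a)

/-! ### Kernels, cokernels, products -/

/-- A homogeneous submodule, as a graded module. -/
noncomputable def ofSubmodule (M : GrMod 𝓡) (p : Submodule Rᵐᵒᵖ M)
    (hp : ∀ i, ∀ m ∈ p, M.proj i m ∈ p) : GrMod 𝓡 where
  carrier := p
  piece i := (M.piece i).comap p.subtype.toAddMonoidHom
  isInternal := by
    refine isInternal_of_proj _
      (fun i => ((M.proj i).comp p.subtype.toAddMonoidHom).codRestrict p (fun x => hp i _ x.2))
      ?_ ?_ ?_
    · intro i a ha
      exact Subtype.ext (M.proj_same ha)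
    · intro i j hij a ha
      exact Subtype.ext (M.proj_ne ha hij)
    · intro a
      obtain ⟨s, hs⟩ := M.exists_sum_proj a.1
      have : a = ∑ i ∈ s, (⟨M.proj i a.1, hp i _ a.2⟩ : p) := by
        apply Subtype.ext
        simpa using hs.symm
      rw [this]
      refine sum_mem fun i _ => AddSubgroup.mem_iSup_of_mem i ?_
      exact M.proj_mem i a.1
  smul_mem hr hm := M.smul_mem hr hm

/-- The quotient by a homogeneous submodule, as a graded module. -/
noncomputable def quotient (M : GrMod 𝓡) (p : Submodule Rᵐᵒᵖ M)
    (hp : ∀ i, ∀ m ∈ p, M.proj i m ∈ p) : GrMod 𝓡 where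
  carrier := M ⧸ p
  piece i := (M.piece i).map p.mkQ.toAddMonoidHom
  isInternal := by
    refine isInternal_of_proj _
      (fun i => QuotientAddGroup.map p.toAddSubgroup p.toAddSubgroup (M.proj i) (hp i)) ?_ ?_ ?_
    · rintro i _ ⟨m, hm, rfl⟩
      exact congrArg p.mkQ (M.proj_same hm)
    · rintro i j hij _ ⟨m, hm, rfl⟩
      exact (congrArg p.mkQ (M.proj_ne hm hij)).trans (map_zero _)
    · intro a
      obtain ⟨m, rfl⟩ := p.mkQ_surjective a
      obtain ⟨s, hs⟩ := M.exists_sum_proj m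
      rw [← hs, map_sum]
      exact sum_mem fun i _ => AddSubgroup.mem_iSup_of_mem i ⟨_, M.proj_mem i m, rfl⟩
  smul_mem := by
    rintro i j r _ hr ⟨m, hm, rfl⟩
    exact ⟨_, M.smul_mem hr hm, rfl⟩

/-- The product of two graded modules. -/
noncomputable def prod (M N : GrMod 𝓡) : GrMod 𝓡 where
  carrier := M × N
  piece i := (M.piece i).prod (N.piece i)
  isInternal := by
    refine isInternal_of_proj _ (fun i => (M.proj i).prodMap (N.proj i)) ?_ ?_ ?_
    · rintro i ⟨a, b⟩ ⟨ha, hb⟩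
      exact Prod.ext (M.proj_same ha) (N.proj_same hb)
    · rintro i j hij ⟨a, b⟩ ⟨ha, hb⟩
      exact Prod.ext (M.proj_ne ha hij) (N.proj_ne hb hij)
    · rintro ⟨a, b⟩
      obtain ⟨s, hs⟩ := M.exists_sum_proj a
      obtain ⟨t, ht⟩ := N.exists_sum_proj b
      have : ((a, b) : M × N) = ∑ i ∈ s, (M.proj i a, (0 : N)) + ∑ i ∈ t, ((0 : M), N.proj i b) := by
        ext
        · simp [Prod.fst_sum, hs]
        · simp [Prod.snd_sum, ht]
      rw [this]
      refine add_mem (sum_mem fun i _ => ?_) (sum_mem fun i _ => ?_)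
      · exact AddSubgroup.mem_iSup_of_mem i ⟨M.proj_mem i a, zero_mem _⟩
      · exact AddSubgroup.mem_iSup_of_mem i ⟨zero_mem _, N.proj_mem i b⟩
  smul_mem hr hm := ⟨M.smul_mem hr hm.1, N.smul_mem hr hm.2⟩

/-- The zero graded module. -/
noncomputable def zeroObj (𝓡 : ℤ → σ) : GrMod 𝓡 where
  carrier := PUnit
  piece _ := ⊥
  isInternal := isInternal_of_proj _ (fun _ => 0) (fun _ _ _ => rfl) (fun _ _ _ _ _ => rfl)
    (fun _ => zero_mem _)
  smul_mem _ _ := rfl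

lemma isZero_zeroObj (𝓡 : ℤ → σ) : IsZero (zeroObj 𝓡) := by
  rw [IsZero.iff_id_eq_zero]
  ext m
  rfl

instance : HasZeroObject (GrMod 𝓡) := ⟨⟨_, isZero_zeroObj 𝓡⟩⟩

section Kernel

variable {M N : GrMod 𝓡} (f : M ⟶ N)

lemma ker_homogeneous (i : ℤ) (m : M) (hm : m ∈ LinearMap.ker f.lin) :
    M.proj i m ∈ LinearMap.ker f.lin := by
  rw [LinearMap.mem_ker] at hm ⊢
  rw [lin_proj, hm, map_zero]

lemma range_homogeneous (i : ℤ) (n : N) (hn : n ∈ LinearMap.range f.lin) :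
    N.proj i n ∈ LinearMap.range f.lin := by
  obtain ⟨m, rfl⟩ := hn
  exact ⟨M.proj i m, lin_proj f i m⟩

/-- The kernel of a morphism of graded modules. -/
noncomputable def kerObj : GrMod 𝓡 := M.ofSubmodule (LinearMap.ker f.lin) (ker_homogeneous f)

/-- The inclusion of the kernel. -/
noncomputable def kerι : kerObj f ⟶ M where
  lin := (LinearMap.ker f.lin).subtype
  map_mem h := h

/-- The cokernel of a morphism of graded modules. -/
noncomputable def cokerObj : GrMod 𝓡 := N.quotient (LinearMap.range f.lin) (range_homogeneous f)

/-- The projection to the cokernel. -/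
noncomputable def cokerπ : N ⟶ cokerObj f where
  lin := (LinearMap.range f.lin).mkQ
  map_mem h := ⟨_, h, rfl⟩

lemma kerι_comp : kerι f ≫ f = 0 := by
  ext m
  exact m.2

lemma comp_cokerπ : f ≫ cokerπ f = 0 := by
  ext m
  exact (Submodule.Quotient.mk_eq_zero _).2 ⟨m, rfl⟩

/-- `kerObj f` is a kernel of `f`. -/
noncomputable def kerIsLimit : IsLimit (KernelFork.ofι (kerι f) (kerι_comp f)) :=
  KernelFork.IsLimit.ofι _ _
    (fun {A} g hg =>
      ({ lin := g.lin.codRestrict (LinearMap.ker f.lin) (fun a => lin_apply_eq_zero hg a)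
         map_mem := fun h => g.map_mem h } : Hom A (kerObj f)))
    (fun _ _ => rfl)
    (fun g hg k hk => by
      ext a
      apply Subtype.ext
      have := congrArg (fun l => Hom.lin l a) hk
      exact this)

/-- `cokerObj f` is a cokernel of `f`. -/
noncomputable def cokerIsColimit : IsColimit (CokernelCofork.ofπ (cokerπ f) (comp_cokerπ f)) :=
  CokernelCofork.IsColimit.ofπ _ _
    (fun {A} g hg =>
      ({ lin := (LinearMap.range f.lin).liftQ g.lin (by
           rintro _ ⟨m, rfl⟩
           exact lin_apply_eq_zero hg m)
         map_mem := by
           rintro i _ ⟨m, hm, rfl⟩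
           exact g.map_mem hm } : Hom (cokerObj f) A))
    (fun _ _ => rfl)
    (fun g hg k hk => by
      ext a
      obtain ⟨n, rfl⟩ := Submodule.mkQ_surjective _ a
      have := congrArg (fun l => Hom.lin l n) hk
      exact this)

lemma injective_of_mono [Mono f] : Function.Injective f.lin := by
  rw [injective_iff_map_eq_zero]
  intro m hm
  have h : kerι f = 0 := by
    rw [← cancel_mono f, kerι_comp, zero_comp]
  exact congrArg (fun l => Hom.lin l (⟨m, hm⟩ : LinearMap.ker f.lin)) h

lemma surjective_of_epi [Epi f] : Function.Surjective f.lin := by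
  intro n
  have h : cokerπ f = 0 := by
    rw [← cancel_epi f, comp_cokerπ, comp_zero]
  have h' := congrArg (fun l => Hom.lin l n) h
  exact (Submodule.Quotient.mk_eq_zero _).1 h'

lemma mem_of_injective (hf : Function.Injective f.lin) {i : ℤ} {m : M}
    (hm : f.lin m ∈ N.piece i) : m ∈ M.piece i := by
  have : M.proj i m = m := hf (by rw [lin_proj, N.proj_same hm])
  rw [← this]
  exact M.proj_mem i m

lemma exists_mem_of_surjective (hf : Function.Surjective f.lin) {i : ℤ} {n : N}
    (hn : n ∈ N.piece i) : ∃ m ∈ M.piece i, f.lin m = n := by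
  obtain ⟨m, rfl⟩ := hf n
  exact ⟨M.proj i m, M.proj_mem i m, by rw [lin_proj, N.proj_same hn]⟩

/-- A monomorphism is a kernel of its cokernel. -/
noncomputable def monoIsLimit (hf : Function.Injective f.lin) :
    IsLimit (KernelFork.ofι f (comp_cokerπ f)) :=
  have key : ∀ {A : GrMod 𝓡} (g : A ⟶ N) (hg : g ≫ cokerπ f = 0) (a : A),
      f.lin ((LinearEquiv.ofInjective f.lin hf).symm
        (g.lin.codRestrict (LinearMap.range f.lin) (fun a =>
          (Submodule.Quotient.mk_eq_zero _).1 (lin_apply_eq_zero hg a)) a)) = g.lin a :=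
    fun g hg a => congrArg Subtype.val ((LinearEquiv.ofInjective f.lin hf).apply_symm_apply _)
  KernelFork.IsLimit.ofι _ _
    (fun {A} g hg =>
      ({ lin := (LinearEquiv.ofInjective f.lin hf).symm.toLinearMap ∘ₗ
           g.lin.codRestrict (LinearMap.range f.lin) (fun a =>
             (Submodule.Quotient.mk_eq_zero _).1 (lin_apply_eq_zero hg a))
         map_mem := fun {i} {a} h => mem_of_injective f hf (by
           rw [LinearMap.comp_apply, LinearEquiv.coe_coe, key g hg a]
           exact g.map_mem h) } : Hom A M))
    (fun g hg => by
      ext a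
      exact key g hg a)
    (fun g hg k hk => by
      ext a
      apply hf
      have h1 := congrArg (fun l => Hom.lin l a) hk
      exact h1.trans (key g hg a).symm)

/-- An epimorphism is a cokernel of its kernel. -/
noncomputable def epiIsColimit (hf : Function.Surjective f.lin) :
    IsColimit (CokernelCofork.ofπ f (kerι_comp f)) :=
  have key : ∀ {A : GrMod 𝓡} (g : M ⟶ A) (hg : kerι f ≫ g = 0) (m : M),
      ((LinearMap.ker f.lin).liftQ g.lin (fun m hm =>
        lin_apply_eq_zero hg (⟨m, hm⟩ : LinearMap.ker f.lin)))
        ((f.lin.quotKerEquivOfSurjective hf).symm (f.lin m)) = g.lin m := by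
    intro A g hg m
    have : (f.lin.quotKerEquivOfSurjective hf).symm (f.lin m) =
        (LinearMap.ker f.lin).mkQ m := by
      rw [LinearEquiv.symm_apply_eq]
      rfl
    rw [this]
    rfl
  CokernelCofork.IsColimit.ofπ _ _
    (fun {A} g hg =>
      ({ lin := ((LinearMap.ker f.lin).liftQ g.lin (fun m hm =>
           lin_apply_eq_zero hg (⟨m, hm⟩ : LinearMap.ker f.lin))) ∘ₗ
             (f.lin.quotKerEquivOfSurjective hf).symm.toLinearMap
         map_mem := by
           intro i n hn
           obtain ⟨m, hm, rfl⟩ := exists_mem_of_surjective f hf hn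
           rw [LinearMap.comp_apply, LinearEquiv.coe_coe, key g hg m]
           exact g.map_mem hm } : Hom N A))
    (fun g hg => by
      ext m
      exact key g hg m)
    (fun g hg k hk => by
      ext n
      obtain ⟨m, rfl⟩ := hf n
      have h1 := congrArg (fun l => Hom.lin l m) hk
      exact h1.trans (key g hg m).symm)

end Kernel

instance : HasKernels (GrMod 𝓡) := ⟨fun f => ⟨⟨⟨_, kerIsLimit f⟩⟩⟩⟩

instance : HasCokernels (GrMod 𝓡) := ⟨fun f => ⟨⟨⟨_, cokerIsColimit f⟩⟩⟩⟩

/-- The binary fan given by `GrMod.prod`. -/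
noncomputable def prodFan (M N : GrMod 𝓡) : BinaryFan M N :=
  BinaryFan.mk (P := M.prod N)
    ({ lin := LinearMap.fst Rᵐᵒᵖ M N, map_mem := fun h => h.1 } : Hom (M.prod N) M)
    ({ lin := LinearMap.snd Rᵐᵒᵖ M N, map_mem := fun h => h.2 } : Hom (M.prod N) N)

/-- `GrMod.prod` is a product. -/
noncomputable def prodIsLimit (M N : GrMod 𝓡) : IsLimit (prodFan M N) :=
  BinaryFan.IsLimit.mk _
    (fun {A} f g =>
      ({ lin := f.lin.prod g.lin
         map_mem := fun h => ⟨f.map_mem h, g.map_mem h⟩ } : Hom A (M.prod N)))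
    (fun _ _ => rfl) (fun _ _ => rfl)
    (fun f g k h1 h2 => by
      ext a
      exact Prod.ext (congrArg (fun l => Hom.lin l a) h1) (congrArg (fun l => Hom.lin l a) h2))

instance : HasBinaryProducts (GrMod 𝓡) :=
  have : ∀ {M N : GrMod 𝓡}, HasLimit (pair M N) := fun {M N} => ⟨⟨⟨_, prodIsLimit M N⟩⟩⟩
  hasBinaryProducts_of_hasLimit_pair _

instance : HasTerminal (GrMod 𝓡) := (isZero_zeroObj 𝓡).isTerminal.hasTerminal

/-- The category of graded right modules is abelian. -/
noncomputable instance : Abelian (GrMod 𝓡) where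
  normalMonoOfMono f := ⟨⟨_, cokerπ f, comp_cokerπ f, monoIsLimit f (injective_of_mono f)⟩⟩
  normalEpiOfEpi f := ⟨⟨_, kerι f, kerι_comp f, epiIsColimit f (surjective_of_epi f)⟩⟩
  has_finite_products := hasFiniteProducts_of_has_binary_and_terminal
  has_kernels := inferInstance
  has_cokernels := inferInstance

/-- The linear equivalence underlying an isomorphism of graded modules. -/
noncomputable def linearEquivOfIso {M N : GrMod 𝓡} (e : M ≅ N) : M ≃ₗ[Rᵐᵒᵖ] N :=
  LinearEquiv.ofLinearMap e.hom.lin e.inv.lin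
    (by rw [← comp_lin, e.inv_hom_id, id_lin]) (by rw [← comp_lin, e.hom_inv_id, id_lin])

end Basic

end GrMod

/-! ### Graded coherent rings and finitely presented graded modules -/

section Coherent

variable {R : Type u} [Ring R] {σ : Type*} [SetLike σ R] [AddSubmonoidClass σ R] (𝓡 : ℤ → σ)
  [GradedRing 𝓡]

/-- `R` is graded (right) coherent: every finitely generated homogeneous right ideal is finitely
presented as a right module. -/
class IsGradedCoherent : Prop where
  finitePresentation : ∀ I : Submodule Rᵐᵒᵖ R,
    (∀ i : ℤ, ∀ r ∈ I, (decompose 𝓡 r i : R) ∈ I) → I.FG → Module.FinitePresentation Rᵐᵒᵖ I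

/-- For a negatively graded ring `R`, the right ideal `R_{≤ i}` of the elements all of whose
homogeneous components have degree `≤ i`. -/
def rightIdealLE (h : IsNegativelyGraded 𝓡) (i : ℤ) : Submodule Rᵐᵒᵖ R where
  carrier := {r | ∀ j : ℤ, i < j → (decompose 𝓡 r j : R) = 0}
  zero_mem' := by simp
  add_mem' := by
    intro a b ha hb j hj
    simp [decompose_add, ha j hj, hb j hj]
  smul_mem' := by
    intro c r hr
    induction c using MulOpposite.rec' with
    | _ s =>
      change ∀ j : ℤ, i < j → (decompose 𝓡 (r * s) j : R) = 0
      intro j hj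
      induction s using Decomposition.inductionOn 𝓡 with
      | zero => simp
      | @homogeneous l s =>
        by_cases hl : 0 < l
        · simp [h l hl s s.2]
        · have := coe_decompose_mul_add_of_right_mem 𝓡 (i := j - l) (a := r) s.2
          rw [sub_add_cancel, hr (j - l) (by omega), zero_mul] at this
          exact this
      | add s t hs ht => simp [mul_add, decompose_add, -decompose_mul, hs, ht]

/-- The ring `R` as a right module is isomorphic to `Rᵐᵒᵖ`. -/
def opRightEquiv (R : Type u) [Ring R] : R ≃ₗ[Rᵐᵒᵖ] Rᵐᵒᵖ where
  toFun := MulOpposite.op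
  invFun := MulOpposite.unop
  map_add' _ _ := rfl
  map_smul' _ _ := rfl
  left_inv _ := rfl
  right_inv _ := rfl

instance finitePresentation_right (R : Type u) [Ring R] : Module.FinitePresentation Rᵐᵒᵖ R :=
  .of_equiv (opRightEquiv R).symm

/-- Over a graded coherent ring, finitely generated homogeneous submodules of (shifted) finitely
generated free modules are finitely presented. -/
lemma finitePresentation_of_le_free [IsGradedCoherent 𝓡] (n : ℕ) (d : Fin n → ℤ)
    (L : Submodule Rᵐᵒᵖ (Fin n → R))
    (hL : ∀ i : ℤ, ∀ v ∈ L, (fun a => (decompose 𝓡 (v a) (i + d a) : R)) ∈ L) (hfg : L.FG) :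
    Module.FinitePresentation Rᵐᵒᵖ L := by
  induction n with
  | zero => infer_instance
  | succ n ih =>
    have : Module.Finite Rᵐᵒᵖ L := Module.Finite.of_fg hfg
    let φ : L →ₗ[Rᵐᵒᵖ] R := LinearMap.proj (R := Rᵐᵒᵖ) (φ := fun _ : Fin (n + 1) => R) 0 ∘ₗ
      L.subtype
    have hI : Module.FinitePresentation Rᵐᵒᵖ (LinearMap.range φ) := by
      refine IsGradedCoherent.finitePresentation (𝓡 := 𝓡) _ ?_ (Submodule.fg_range _)
      rintro i _ ⟨v, rfl⟩
      refine ⟨⟨_, hL (i - d 0) v.1 v.2⟩, ?_⟩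
      change (decompose 𝓡 (v.1 0) (i - d 0 + d 0) : R) = decompose 𝓡 (v.1 0) i
      rw [sub_add_cancel]
    have hker : (LinearMap.ker φ.rangeRestrict).FG :=
      Module.FinitePresentation.fg_ker _ φ.surjective_rangeRestrict
    let ψ : (Fin (n + 1) → R) →ₗ[Rᵐᵒᵖ] (Fin n → R) :=
      LinearMap.funLeft Rᵐᵒᵖ R Fin.succ
    let K : LinearMap.ker φ.rangeRestrict →ₗ[Rᵐᵒᵖ] (Fin n → R) :=
      ψ ∘ₗ L.subtype ∘ₗ (LinearMap.ker φ.rangeRestrict).subtype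
    have hz : ∀ x : LinearMap.ker φ.rangeRestrict, x.1.1 0 = 0 := by
      intro x
      have := congrArg Subtype.val x.2
      exact this
    have hinj : Function.Injective K := by
      rw [injective_iff_map_eq_zero]
      intro x hx
      apply Subtype.ext
      apply Subtype.ext
      funext a
      refine Fin.cases (hz x) (fun b => ?_) a
      exact congrFun hx b
    have hfin : Module.Finite Rᵐᵒᵖ (LinearMap.ker φ.rangeRestrict) := Module.Finite.of_fg hker
    have hK : Module.FinitePresentation Rᵐᵒᵖ (LinearMap.range K) := by
      refine ih (fun b => d b.succ) _ ?_ (Submodule.fg_range _)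
      rintro i _ ⟨x, rfl⟩
      refine ⟨⟨⟨_, hL i x.1.1 x.1.2⟩, ?_⟩, rfl⟩
      apply Subtype.ext
      change (decompose 𝓡 (x.1.1 0) (i + d 0) : R) = 0
      rw [hz x]
      simp
    have : Module.FinitePresentation Rᵐᵒᵖ (LinearMap.ker φ.rangeRestrict) :=
      (LinearEquiv.finitePresentation_iff (R := Rᵐᵒᵖ) (M := LinearMap.ker φ.rangeRestrict)
        (N := LinearMap.range K) (LinearEquiv.ofInjective K hinj)).2 hK
    exact Module.finitePresentation_of_ker φ.rangeRestrict φ.surjective_rangeRestrict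

namespace GrMod

variable {𝓡}

lemma proj_smul {M : GrMod 𝓡} {j : ℤ} {x : M} (hx : x ∈ M.piece j) (i : ℤ) (r : R) :
    M.proj i (MulOpposite.op r • x) =
      MulOpposite.op (decompose 𝓡 r (i - j) : R) • x := by
  induction r using Decomposition.inductionOn 𝓡 with
  | zero => simp
  | @homogeneous l s =>
    have hm := M.smul_mem s.2 hx
    by_cases h : l = i - j
    · subst h
      rw [decompose_coe, of_eq_same, M.proj_same]
      simpa using hm
    · rw [decompose_coe, of_eq_of_ne _ _ _ (Ne.symm h), M.proj_ne hm (by omega)]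
      simp
  | add s t hs ht => simp [add_smul, decompose_add, hs, ht]

set_option linter.unusedSectionVars false in
lemma exists_homogeneous_generators (M : GrMod 𝓡) [Module.Finite Rᵐᵒᵖ M] :
    ∃ (n : ℕ) (d : Fin n → ℤ) (x : Fin n → M), (∀ a, x a ∈ M.piece (d a)) ∧
      Submodule.span Rᵐᵒᵖ (Set.range x) = ⊤ := by
  classical
  obtain ⟨S, hS⟩ := Module.Finite.fg_top (R := Rᵐᵒᵖ) (M := M)
  choose s hs using M.exists_sum_proj
  let T : Finset (ℤ × M) := S.biUnion fun m => (s m).image fun i => (i, M.proj i m)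
  let e := T.equivFin.symm
  refine ⟨T.card, fun a => (e a).1.1, fun a => (e a).1.2, ?_, ?_⟩
  · intro a
    obtain ⟨m, -, hm⟩ := Finset.mem_biUnion.1 (e a).2
    obtain ⟨i, -, hi⟩ := Finset.mem_image.1 hm
    change (e a).1.2 ∈ M.piece (e a).1.1
    rw [← hi]
    exact M.proj_mem i m
  · rw [eq_top_iff, ← hS, Submodule.span_le]
    intro m hm
    rw [← hs m]
    refine sum_mem fun i hi => Submodule.subset_span ?_
    have : (i, M.proj i m) ∈ T :=
      Finset.mem_biUnion.2 ⟨m, hm, Finset.mem_image.2 ⟨i, hi, rfl⟩⟩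
    exact ⟨T.equivFin ⟨_, this⟩, by simp [e]⟩

lemma finitePresentation_of_homogeneous [IsGradedCoherent 𝓡] (N : GrMod 𝓡)
    [Module.FinitePresentation Rᵐᵒᵖ N] (L : Submodule Rᵐᵒᵖ N)
    (hL : ∀ i, ∀ m ∈ L, N.proj i m ∈ L) (hfg : L.FG) : Module.FinitePresentation Rᵐᵒᵖ L := by
  obtain ⟨n, d, x, hx, hspan⟩ := N.exists_homogeneous_generators
  let φ : (Fin n → R) →ₗ[Rᵐᵒᵖ] N :=
    Fintype.linearCombination Rᵐᵒᵖ x ∘ₗ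
      LinearMap.pi fun a => (opRightEquiv R).toLinearMap ∘ₗ LinearMap.proj a
  have hφ : ∀ v, φ v = ∑ a, MulOpposite.op (v a) • x a := fun v => rfl
  have hsurj : Function.Surjective φ := by
    intro y
    have hy : y ∈ Submodule.span Rᵐᵒᵖ (Set.range x) := hspan ▸ Submodule.mem_top
    obtain ⟨c, rfl⟩ := (Submodule.mem_span_range_iff_exists_fun _).1 hy
    exact ⟨fun a => (c a).unop, by simp [hφ]⟩
  have hker : (LinearMap.ker φ).FG := Module.FinitePresentation.fg_ker φ hsurj
  have hL' : Module.FinitePresentation Rᵐᵒᵖ (L.comap φ) := by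
    refine finitePresentation_of_le_free 𝓡 n (fun a => - d a) _ ?_ ?_
    · intro i v hv
      have : φ (fun a => (decompose 𝓡 (v a) (i + - d a) : R)) = N.proj i (φ v) := by
        rw [hφ, hφ, map_sum]
        refine Finset.sum_congr rfl fun a _ => ?_
        rw [proj_smul (hx a), sub_eq_add_neg]
      rw [Submodule.mem_comap, this]
      exact hL i _ hv
    · refine Submodule.fg_of_fg_map_of_fg_inf_ker φ ?_ ?_
      · rwa [Submodule.map_comap_eq_of_surjective hsurj]
      · rwa [inf_eq_right.2]
        exact LinearMap.ker_le_comap φ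
  let ψ : L.comap φ →ₗ[Rᵐᵒᵖ] L := φ.restrict fun _ h => h
  refine Module.finitePresentation_of_surjective ψ ?_ ?_
  · rintro ⟨y, hy⟩
    obtain ⟨v, rfl⟩ := hsurj y
    exact ⟨⟨v, hy⟩, rfl⟩
  · have : LinearMap.ker ψ = (LinearMap.ker φ).comap (L.comap φ).subtype := by
      ext v
      simp [ψ, Subtype.ext_iff]
    rw [this]
    refine Submodule.fg_of_fg_map_injective (L.comap φ).subtype
      (Submodule.injective_subtype _) ?_
    rwa [Submodule.map_comap_eq, Submodule.range_subtype, inf_eq_right.2]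
    exact LinearMap.ker_le_comap φ

/-- Finitely presented graded modules. -/
def finPres (𝓡 : ℤ → σ) : ObjectProperty (GrMod 𝓡) := fun M => Module.FinitePresentation Rᵐᵒᵖ M

set_option linter.unusedSectionVars false in
lemma finPres_of_iso {M N : GrMod 𝓡} (e : M ≅ N) (h : finPres 𝓡 M) : finPres 𝓡 N := by
  have : Module.FinitePresentation Rᵐᵒᵖ M := h
  exact Module.FinitePresentation.of_equiv (linearEquivOfIso e)

instance : (finPres 𝓡).IsClosedUnderIsomorphisms := ⟨fun e h => finPres_of_iso e h⟩

instance : (finPres 𝓡).ContainsZero :=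
  ⟨⟨zeroObj 𝓡, isZero_zeroObj 𝓡,
    inferInstanceAs (Module.FinitePresentation Rᵐᵒᵖ PUnit.{u + 1})⟩⟩

instance [IsGradedCoherent 𝓡] : (finPres 𝓡).IsClosedUnderKernels where
  kernels_le := by
    intro X hX
    obtain @⟨M, N, f, k, hk, hM, hN⟩ := hX
    refine finPres_of_iso ((kerIsLimit f).conePointUniqueUpToIso hk) ?_
    have : Module.FinitePresentation Rᵐᵒᵖ M := hM
    have : Module.FinitePresentation Rᵐᵒᵖ N := hN
    have hr : Module.FinitePresentation Rᵐᵒᵖ (LinearMap.range f.lin) :=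
      N.finitePresentation_of_homogeneous _ (range_homogeneous f) (Submodule.fg_range _)
    have hker : (LinearMap.ker f.lin).FG := by
      have := Module.FinitePresentation.fg_ker _ f.lin.surjective_rangeRestrict
      rwa [LinearMap.ker_rangeRestrict] at this
    exact M.finitePresentation_of_homogeneous _ (ker_homogeneous f) hker

instance : (finPres 𝓡).IsClosedUnderCokernels where
  cokernels_le := by
    intro X hX
    obtain @⟨M, N, f, k, hk, hM, hN⟩ := hX
    refine finPres_of_iso ((cokerIsColimit f).coconePointUniqueUpToIso hk) ?_
    have : Module.FinitePresentation Rᵐᵒᵖ M := hM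
    have : Module.FinitePresentation Rᵐᵒᵖ N := hN
    have hq : Module.FinitePresentation Rᵐᵒᵖ (N ⧸ LinearMap.range f.lin) :=
      Module.finitePresentation_of_surjective (LinearMap.range f.lin).mkQ
        (Submodule.mkQ_surjective _) (by rw [Submodule.ker_mkQ]; exact Submodule.fg_range _)
    exact hq

instance : (finPres 𝓡).IsClosedUnderBinaryProducts where
  limitsOfShape_le := by
    rintro X ⟨p⟩
    let e : p.diag ≅ pair (p.diag.obj ⟨.left⟩) (p.diag.obj ⟨.right⟩) := diagramIsoPair _
    have hl := (IsLimit.postcomposeHomEquiv e _).symm p.isLimit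
    refine finPres_of_iso ((prodIsLimit _ _).conePointUniqueUpToIso hl) ?_
    have h1 : Module.FinitePresentation Rᵐᵒᵖ (p.diag.obj ⟨.left⟩) := p.prop_diag_obj _
    have h2 : Module.FinitePresentation Rᵐᵒᵖ (p.diag.obj ⟨.right⟩) := p.prop_diag_obj _
    exact inferInstanceAs (Module.FinitePresentation Rᵐᵒᵖ
      (p.diag.obj ⟨.left⟩ × p.diag.obj ⟨.right⟩))

instance : (finPres 𝓡).IsClosedUnderFiniteProducts := .mk'

end GrMod

/-- The category of finitely presented graded right `R`-modules. It is abelian when `R` is graded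
coherent. -/
abbrev FPGrMod := (GrMod.finPres 𝓡).FullSubcategory

noncomputable instance [IsGradedCoherent 𝓡] : Abelian (FPGrMod 𝓡) := inferInstance

end Coherent

/-! ### Perfect complexes and finite projective resolutions -/

section Perfect

variable {R : Type u} [Ring R] {σ : Type*} [SetLike σ R] (𝓡 : ℤ → σ)

/-- Finitely generated graded projective modules. -/
def finProj : ObjectProperty (GrMod 𝓡) := fun P => Module.Finite Rᵐᵒᵖ P ∧ Projective P

/-- Graded modules which have a finite resolution `0 → P_n → ⋯ → P_0 → M → 0` by finitely generated
graded projective modules. -/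
inductive HasFiniteProjResolution : GrMod 𝓡 → Prop
  | of_finProj {P : GrMod 𝓡} : finProj 𝓡 P → HasFiniteProjResolution P
  | of_shortExact {S : ShortComplex (GrMod 𝓡)} : S.ShortExact → finProj 𝓡 S.X₂ →
      HasFiniteProjResolution S.X₁ → HasFiniteProjResolution S.X₃

instance : (finProj 𝓡).Nonempty :=
  ⟨GrMod.zeroObj 𝓡, inferInstanceAs (Module.Finite Rᵐᵒᵖ PUnit.{u + 1}),
    ⟨fun _ _ _ => ⟨0, (GrMod.isZero_zeroObj 𝓡).eq_of_src _ _⟩⟩⟩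

variable [HasDerivedCategory.{w} (GrMod 𝓡)]

/-- The perfect objects of the derived category of graded modules: the thick subcategory generated
by the finitely generated graded projective modules, placed in degree `0`. -/
def perfect : ObjectProperty (DerivedCategory (GrMod 𝓡)) :=
  ((finProj 𝓡).map (DerivedCategory.singleFunctor (GrMod 𝓡) 0)).triangEnvelope

instance : ((finProj 𝓡).map (DerivedCategory.singleFunctor (GrMod 𝓡) 0)).Nonempty := by
  obtain ⟨P, hP⟩ := (inferInstance : (finProj 𝓡).Nonempty)
  exact ⟨_, ObjectProperty.prop_map_obj _ _ hP⟩

instance : (perfect 𝓡).IsTriangulated := by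
  unfold perfect
  infer_instance

/-- The perfect derived category `per^ℤ R`. -/
abbrev PerfectDerivedCategory := (perfect 𝓡).FullSubcategory

end Perfect

/-! ### The `t`-structure attached to a grading on an abelian category -/

/-! Since `R` is negatively graded, the elements of degree `≤ a` form a submodule `M_{≤ a}` of each
graded module `M`, functorially in `M`. Call a morphism from an object in degrees `≤ a` to one in
degrees `> a` orthogonal; it vanishes, because its image has no nonzero component. Both parts rest
on these two facts, so the argument is carried out in an abstract abelian category `A` with such
truncations.

Given a complex `K`, let `F K` be the subcomplex of those `x ∈ K^i` of degree `≤ -i` with `dx` of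
degree `≤ -(i+1)`. The homology of `F K` lies in degrees `≤ -i`. A cycle of `K / F K` is determined
by its part of degree `> -i`, so the homology of the quotient lies in degrees `> -i`
(`prop_homology_cokernel`). Thus `F K → K → K / F K` is the truncation triangle. Orthogonality in
the derived category follows from the functoriality of `F` (`hom_Q_obj_eq_zero`). This gives a
`t`-structure on all of `D(A)`, and it remains to see that it restricts.

In a truncation triangle `U → X → V → U[1]` the connecting maps in homology are orthogonal, hence
zero, and `H^i(V)` is a quotient of `H^i(X)`. So boundedness is inherited, which settles part (2)
once the truncations of finitely presented modules are finitely presented; this comes from (R3).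

For part (1), `X` perfect is bounded and the quotients `H^i(X) / H^i(X)_{≤ a}` have finite length,
by (R1). Therefore `V` is bounded with homology of finite length. By (R2) modules of finite length
are perfect, and dévissage (`boundedHomology_le`) shows that `V` is perfect, hence so is `U`. -/

section DegreeVanishing

variable {A : Type*} [Category* A] [Abelian A]

/-- A family of properties `Z j` of objects in an abelian category, where `Z j M` is to be thought
of as the vanishing of the component of degree `j` of `M`, such that each object has a largest
subobject concentrated in degrees `≤ a`, for each `a : ℤ`, with a quotient in degrees `> a`. -/
class IsDegreeVanishing (Z : ℤ → ObjectProperty A) : Prop where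
  isClosedUnderSubobjects (j : ℤ) : (Z j).IsClosedUnderSubobjects
  isClosedUnderQuotients (j : ℤ) : (Z j).IsClosedUnderQuotients
  isZero (M : A) (h : ∀ j, Z j M) : IsZero M
  exists_trunc (M : A) (a : ℤ) : ∃ (N : A) (π : M ⟶ N),
    (∀ j, j ≤ a → Z j N) ∧ ∀ j, a < j → Z j (kernel π)

attribute [instance] IsDegreeVanishing.isClosedUnderSubobjects
  IsDegreeVanishing.isClosedUnderQuotients

namespace IsDegreeVanishing

variable (Z : ℤ → ObjectProperty A) [IsDegreeVanishing Z]

variable {Z} in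
-- The image is both a quotient of `M` and a subobject of `N`, so all its components vanish.
lemma eq_zero {M N : A} (f : M ⟶ N) (h : ∀ j, Z j M ∨ Z j N) : f = 0 := by
  have : IsZero (image f) := isZero (Z := Z) _ fun j => by
    rcases h j with h | h
    · exact (Z j).prop_of_epi (factorThruImage f) h
    · exact (Z j).prop_of_mono (image.ι f) h
  rw [← image.fac f, this.eq_of_tgt (factorThruImage f) 0, zero_comp]

/-- A quotient of `M` in degrees `> a` by a subobject in degrees `≤ a`. -/
noncomputable def truncGT (M : A) (a : ℤ) : A := (exists_trunc (Z := Z) M a).choose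

/-- The projection to the truncation. -/
noncomputable def truncGTπ (M : A) (a : ℤ) : M ⟶ truncGT Z M a :=
  (exists_trunc (Z := Z) M a).choose_spec.choose

lemma prop_truncGT (M : A) (a j : ℤ) (h : j ≤ a) : Z j (truncGT Z M a) :=
  (exists_trunc (Z := Z) M a).choose_spec.choose_spec.1 j h

lemma prop_kernel_truncGTπ (M : A) (a j : ℤ) (h : a < j) : Z j (kernel (truncGTπ Z M a)) :=
  (exists_trunc (Z := Z) M a).choose_spec.choose_spec.2 j h

/-- Functoriality of `M_{≤ a}`, on generalized elements: `M_{≤ a} → M → N → N_{> a}` is zero by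
`eq_zero`. -/
lemma comp_truncGTπ_eq_zero {W M N : A} {a : ℤ} (x : W ⟶ M) (hx : x ≫ truncGTπ Z M a = 0)
    (f : M ⟶ N) : x ≫ f ≫ truncGTπ Z N a = 0 := by
  have : kernel.ι (truncGTπ Z M a) ≫ f ≫ truncGTπ Z N a = 0 := eq_zero (Z := Z) _ fun j => by
    rcases le_or_gt j a with h | h
    · exact Or.inr (prop_truncGT Z N a j h)
    · exact Or.inl (prop_kernel_truncGTπ Z M a j h)
  rw [← kernel.lift_ι _ x hx, Category.assoc, this, comp_zero]

/-! ### The truncation of a complex along the line "degree `= -i`" -/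

variable (K L : CochainComplex A ℤ)

/-- The morphism whose kernel is the degree `i` term of `subcomplex Z K`. -/
noncomputable def toTrunc (i : ℤ) :
    K.X i ⟶ truncGT Z (K.X i) (-i) ⊞ truncGT Z (K.X (i + 1)) (-(i + 1)) :=
  biprod.lift (truncGTπ Z _ _) (K.d i (i + 1) ≫ truncGTπ Z _ _)

variable {K} in
lemma comp_toTrunc_eq_zero {W : A} {i : ℤ} (x : W ⟶ K.X i)
    (h₁ : x ≫ truncGTπ Z (K.X i) (-i) = 0)
    (h₂ : x ≫ K.d i (i + 1) ≫ truncGTπ Z (K.X (i + 1)) (-(i + 1)) = 0) :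
    x ≫ toTrunc Z K i = 0 := by
  refine biprod.hom_ext _ _ ?_ ?_
  · simpa [toTrunc] using h₁
  · simpa [toTrunc] using h₂

lemma kernel_ι_truncGTπ (i : ℤ) :
    kernel.ι (toTrunc Z K i) ≫ truncGTπ Z (K.X i) (-i) = 0 := by
  have := kernel.condition (toTrunc Z K i) =≫ biprod.fst
  rwa [Category.assoc, toTrunc, biprod.lift_fst, zero_comp] at this

lemma kernel_ι_d_truncGTπ (i j : ℤ) :
    kernel.ι (toTrunc Z K i) ≫ K.d i j ≫ truncGTπ Z (K.X j) (-j) = 0 := by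
  by_cases h : i + 1 = j
  · subst h
    have := kernel.condition (toTrunc Z K i) =≫ biprod.snd
    rwa [Category.assoc, toTrunc, biprod.lift_snd, zero_comp] at this
  · rw [K.shape i j h, zero_comp, comp_zero]

/-- The largest subcomplex of `K` whose term in each degree `i` is concentrated in
degrees `≤ -i`. -/
noncomputable def subcomplex : CochainComplex A ℤ where
  X i := kernel (toTrunc Z K i)
  d i j := kernel.lift _ (kernel.ι _ ≫ K.d i j)
    (comp_toTrunc_eq_zero Z _ (by rw [Category.assoc, kernel_ι_d_truncGTπ])
      (by simp))
  shape i j h := by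
    rw [← cancel_mono (kernel.ι _), kernel.lift_ι, K.shape i j h, comp_zero, zero_comp]
  d_comp_d' i j k _ _ := by
    rw [← cancel_mono (kernel.ι _)]
    simp

/-- The inclusion of `subcomplex Z K`. -/
noncomputable def subcomplexι : subcomplex Z K ⟶ K where
  f i := kernel.ι _
  comm' i j _ := by simp [subcomplex]

instance (i : ℤ) : Mono ((subcomplexι Z K).f i) :=
  inferInstanceAs (Mono (kernel.ι (toTrunc Z K i)))

instance : Mono (subcomplexι Z K) := HomologicalComplex.mono_of_mono_f _ inferInstance

lemma subcomplexι_f_truncGTπ (i : ℤ) :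
    (subcomplexι Z K).f i ≫ truncGTπ Z (K.X i) (-i) = 0 :=
  kernel_ι_truncGTπ Z K i

lemma subcomplexι_f_d_truncGTπ (i j : ℤ) :
    (subcomplexι Z K).f i ≫ K.d i j ≫ truncGTπ Z (K.X j) (-j) = 0 :=
  kernel_ι_d_truncGTπ Z K i j

variable {K} in
lemma exists_comp_subcomplexι_f {W : A} {i : ℤ} (x : W ⟶ K.X i)
    (h₁ : x ≫ truncGTπ Z (K.X i) (-i) = 0)
    (h₂ : x ≫ K.d i (i + 1) ≫ truncGTπ Z (K.X (i + 1)) (-(i + 1)) = 0) :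
    ∃ y : W ⟶ (subcomplex Z K).X i, y ≫ (subcomplexι Z K).f i = x :=
  ⟨kernel.lift _ x (comp_toTrunc_eq_zero Z x h₁ h₂), kernel.lift_ι _ _ _⟩

lemma subcomplexι_f_cokernel_π_f (i : ℤ) :
    (subcomplexι Z K).f i ≫ (cokernel.π (subcomplexι Z K)).f i = 0 := by
  rw [← HomologicalComplex.comp_f, cokernel.condition, HomologicalComplex.zero_f]

/-- The short exact sequence of complexes with quotient of `K` by `subcomplex Z K`. -/
noncomputable abbrev subcomplexShortComplex : ShortComplex (CochainComplex A ℤ) :=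
  ShortComplex.mk (subcomplexι Z K) (cokernel.π (subcomplexι Z K)) (cokernel.condition _)

lemma subcomplexShortComplex_shortExact : (subcomplexShortComplex Z K).ShortExact where
  exact := ShortComplex.exact_cokernel _

lemma prop_homology_subcomplex (i j : ℤ) (h : -i < j) : Z j ((subcomplex Z K).homology i) := by
  have : Mono (kernel.lift _ _ (subcomplexι_f_truncGTπ Z K i)) :=
    mono_of_mono_fac (kernel.lift_ι _ _ (subcomplexι_f_truncGTπ Z K i))
  have h₁ : Z j ((subcomplex Z K).X i) := (Z j).prop_of_mono
    (kernel.lift _ _ (subcomplexι_f_truncGTπ Z K i)) (prop_kernel_truncGTπ Z _ _ _ h)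
  exact (Z j).prop_of_epi ((subcomplex Z K).homologyπ i)
    ((Z j).prop_of_mono ((subcomplex Z K).iCycles i) h₁)

/-- The cycles of the quotient complex in degree `i` embed into the part of `K.X i` of degree `>
-i`, and homology is a quotient of the cycles. -/
lemma prop_homology_cokernel (i j : ℤ) (h : j ≤ -i) :
    Z j ((cokernel (subcomplexι Z K)).homology i) := by
  have hS : ∀ n, ((subcomplexShortComplex Z K).map (HomologicalComplex.eval A _ n)).ShortExact :=
    fun n => (subcomplexShortComplex_shortExact Z K).map_of_exact _
  have := (hS i).epi_g
  let C := cokernel (subcomplexι Z K)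
  let φ : C.X i ⟶ truncGT Z (K.X i) (-i) :=
    (hS i).exact.desc (truncGTπ Z (K.X i) (-i)) (subcomplexι_f_truncGTπ Z K i)
  have hφ : (cokernel.π (subcomplexι Z K)).f i ≫ φ = truncGTπ Z (K.X i) (-i) :=
    (hS i).exact.g_desc _ _
  -- Let `x` in `K.X i` represent a cycle of the quotient complex, so that `dx` lies in the
  -- subcomplex and has degree `≤ -(i+1)`. If `φ` kills the class, `x` has degree `≤ -i`; then `x`
  -- itself lies in the subcomplex and its class is zero. Elements of `K.X i` exist only after
  -- refining `g` along an epimorphism `p`.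
  have : Mono (C.iCycles i ≫ φ) := by
    refine Preadditive.mono_of_cancel_zero _ fun {W} g hg => ?_
    obtain ⟨W', p, hp, x, hx⟩ := surjective_up_to_refinements_of_epi
      ((cokernel.π (subcomplexι Z K)).f i) (g ≫ C.iCycles i)
    have hd : (x ≫ K.d i (i + 1)) ≫ (cokernel.π (subcomplexι Z K)).f (i + 1) = 0 := by
      rw [Category.assoc, ← HomologicalComplex.Hom.comm, ← reassoc_of% hx]
      simp [C]
    have := (hS (i + 1)).mono_f
    obtain ⟨y, hy⟩ : ∃ y, y ≫ (subcomplexι Z K).f (i + 1) = x ≫ K.d i (i + 1) :=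
      ⟨(hS (i + 1)).exact.lift _ hd, (hS (i + 1)).exact.lift_f _ _⟩
    obtain ⟨z, rfl⟩ := exists_comp_subcomplexι_f Z x
      (by
        rw [← hφ, ← reassoc_of% hx]
        exact p ≫= hg |>.trans comp_zero)
      (by rw [← Category.assoc, ← hy, Category.assoc, subcomplexι_f_truncGTπ, comp_zero])
    rw [← cancel_mono (C.iCycles i), ← cancel_epi p, hx, Category.assoc,
      subcomplexι_f_cokernel_π_f, zero_comp, comp_zero, comp_zero]
  exact (Z j).prop_of_epi (C.homologyπ i)
    ((Z j).prop_of_mono (C.iCycles i ≫ φ) (prop_truncGT Z _ _ _ h))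

variable {K L} in
-- Functoriality of the subcomplex: both conditions defining it are preserved by `f`, which respects
-- degrees and commutes with `d`.
lemma subcomplexι_comp (f : K ⟶ L) :
    subcomplexι Z K ≫ f ≫ cokernel.π (subcomplexι Z L) = 0 := by
  ext i
  obtain ⟨y, hy⟩ := exists_comp_subcomplexι_f Z ((subcomplexι Z K).f i ≫ f.f i)
    (by
      rw [Category.assoc]
      exact comp_truncGTπ_eq_zero Z _ (subcomplexι_f_truncGTπ Z K i) (f.f i))
    (by
      rw [Category.assoc, f.comm_assoc, ← Category.assoc]
      exact comp_truncGTπ_eq_zero Z _ (by rw [Category.assoc, subcomplexι_f_d_truncGTπ]) _)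
  rw [HomologicalComplex.comp_f, HomologicalComplex.comp_f, ← Category.assoc, ← hy,
    Category.assoc, subcomplexι_f_cokernel_π_f, comp_zero, HomologicalComplex.zero_f]

/-! ### The `t`-structure on the derived category -/

section Derived

variable [HasDerivedCategory.{w} A]

open DerivedCategory

/-- The objects `X` of the derived category such that `H^i(X)` is in degrees `≤ n - i`. -/
def homologyLE (n : ℤ) : ObjectProperty (DerivedCategory A) :=
  fun X => ∀ i j : ℤ, n - i < j → Z j ((homologyFunctor A i).obj X)

/-- The objects `X` of the derived category such that `H^i(X)` is in degrees `≥ n - i`. -/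
def homologyGE (n : ℤ) : ObjectProperty (DerivedCategory A) :=
  fun X => ∀ i j : ℤ, j < n - i → Z j ((homologyFunctor A i).obj X)

instance (n : ℤ) : (homologyLE Z n).IsClosedUnderIsomorphisms where
  of_iso e h i j hij := (Z j).prop_of_iso ((homologyFunctor A i).mapIso e) (h i j hij)

instance (n : ℤ) : (homologyGE Z n).IsClosedUnderIsomorphisms where
  of_iso e h i j hij := (Z j).prop_of_iso ((homologyFunctor A i).mapIso e) (h i j hij)

/-- The homology of a shifted object. -/
noncomputable def homologyShiftIso (X : DerivedCategory A) (n i j : ℤ) (h : n + i = j) :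
    (homologyFunctor A i).obj (X⟦n⟧) ≅ (homologyFunctor A j).obj X :=
  ((homologyFunctor A 0).shiftIso n i j h).app X

variable {Z}

/-- The source of `δ` lies in degrees `≥ n + 1 - i`, its target in degrees `≤ n - i - 1`. Hence the
long exact homology sequence breaks into short exact sequences. -/
lemma δ_eq_zero {T : Pretriangulated.Triangle (DerivedCategory A)}
    (n : ℤ) (h₁ : homologyLE Z n T.obj₁) (h₃ : homologyGE Z (n + 1) T.obj₃) (i k : ℤ)
    (hi : i + 1 = k) : HomologySequence.δ T i k hi = 0 :=
  eq_zero (Z := Z) _ fun j => by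
    by_cases h : j ≤ n - i
    · exact Or.inl (h₃ i j (by lia))
    · exact Or.inr (h₁ k j (by lia))

lemma mono_homologyMap_mor₁ {T : Pretriangulated.Triangle (DerivedCategory A)}
    (hT : T ∈ distTriang _) (n : ℤ) (h₁ : homologyLE Z n T.obj₁)
    (h₃ : homologyGE Z (n + 1) T.obj₃) (i : ℤ) : Mono ((homologyFunctor A i).map T.mor₁) :=
  (HomologySequence.mono_homologyMap_mor₁_iff T hT (i - 1) i (by lia)).2
    (δ_eq_zero n h₁ h₃ _ _ _)

lemma epi_homologyMap_mor₂ {T : Pretriangulated.Triangle (DerivedCategory A)}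
    (hT : T ∈ distTriang _) (n : ℤ) (h₁ : homologyLE Z n T.obj₁)
    (h₃ : homologyGE Z (n + 1) T.obj₃) (i : ℤ) : Epi ((homologyFunctor A i).map T.mor₂) :=
  (HomologySequence.epi_homologyMap_mor₂_iff T hT i (i + 1) rfl).2
    (δ_eq_zero n h₁ h₃ _ _ _)

lemma isIso_mor₁ {T : Pretriangulated.Triangle (DerivedCategory A)}
    (hT : T ∈ distTriang _) (n : ℤ) (h₁ : homologyLE Z n T.obj₁)
    (h₃ : homologyGE Z (n + 1) T.obj₃) (h₂ : homologyLE Z n T.obj₂) : IsIso T.mor₁ := by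
  rw [DerivedCategory.isIso_iff]
  intro i
  have := mono_homologyMap_mor₁ hT n h₁ h₃ i
  have : Epi ((homologyFunctor A i).map T.mor₁) :=
    (HomologySequence.epi_homologyMap_mor₁_iff T hT i).2 (eq_zero (Z := Z) _ fun j => by
      by_cases h : j ≤ n - i
      · exact Or.inr (h₃ i j (by lia))
      · exact Or.inl (h₂ i j (by lia)))
  exact isIso_of_mono_of_epi _

lemma isIso_mor₂ {T : Pretriangulated.Triangle (DerivedCategory A)}
    (hT : T ∈ distTriang _) (n : ℤ) (h₁ : homologyLE Z n T.obj₁)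
    (h₃ : homologyGE Z (n + 1) T.obj₃) (h₂ : homologyGE Z (n + 1) T.obj₂) : IsIso T.mor₂ := by
  rw [DerivedCategory.isIso_iff]
  intro i
  have := epi_homologyMap_mor₂ hT n h₁ h₃ i
  have : Mono ((homologyFunctor A i).map T.mor₂) :=
    (HomologySequence.mono_homologyMap_mor₂_iff T hT i).2 (eq_zero (Z := Z) _ fun j => by
      by_cases h : j ≤ n - i
      · exact Or.inr (h₂ i j (by lia))
      · exact Or.inl (h₁ i j (by lia)))
  exact isIso_of_mono_of_epi _

variable (Z)

lemma homologyLE_subcomplex : homologyLE Z 0 (Q.obj (subcomplex Z K)) := fun i j h =>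
  (Z j).prop_of_iso ((homologyFunctorFactors A i).symm.app _)
    (prop_homology_subcomplex Z K i j (by lia))

lemma homologyGE_cokernel : homologyGE Z 1 (Q.obj (cokernel (subcomplexι Z K))) := fun i j h =>
  (Z j).prop_of_iso ((homologyFunctorFactors A i).symm.app _)
    (prop_homology_cokernel Z K i j (by lia))

/-- Represent `f` by a roof `K ← K' → L`. The hypotheses make the inclusion of the subcomplex of
`K'` and the projection from `L` to its quotient quasi-isomorphisms, and the composite through `g`
is zero by functoriality. -/
lemma hom_Q_obj_eq_zero {K L : CochainComplex A ℤ} (f : Q.obj K ⟶ Q.obj L)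
    (hK : homologyLE Z 0 (Q.obj K)) (hL : homologyGE Z 1 (Q.obj L)) : f = 0 := by
  obtain ⟨K', s, _, g, rfl⟩ := right_fac f
  have h₁ : IsIso (Q.map (subcomplexι Z K')) :=
    isIso_mor₁ (triangleOfSES_distinguished (subcomplexShortComplex_shortExact Z K')) 0
      (homologyLE_subcomplex Z K') (homologyGE_cokernel Z K')
      ((homologyLE Z 0).prop_of_iso (asIso (Q.map s)).symm hK)
  have h₂ : IsIso (Q.map (cokernel.π (subcomplexι Z L))) :=
    isIso_mor₂ (triangleOfSES_distinguished (subcomplexShortComplex_shortExact Z L)) 0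
      (homologyLE_subcomplex Z L) (homologyGE_cokernel Z L) hL
  have : Q.map g = 0 := by
    rw [← cancel_epi (Q.map (subcomplexι Z K')),
      ← cancel_mono (Q.map (cokernel.π (subcomplexι Z L))),
      ← Q.map_comp, ← Q.map_comp, Category.assoc, subcomplexι_comp, Q.map_zero, comp_zero,
      zero_comp]
  rw [this, comp_zero]

/-- The `t`-structure on the derived category whose aisle consists of the objects `X` such that
`H^i(X)` is in degrees `≤ -i` for all `i`. -/
noncomputable def tStructure : TStructure (DerivedCategory A) where
  le := homologyLE Z
  ge := homologyGE Z
  le_shift n a n' h X hX i j hij :=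
    (Z j).prop_of_iso (homologyShiftIso X a i (a + i) rfl).symm (hX _ _ (by lia))
  ge_shift n a n' h X hX i j hij :=
    (Z j).prop_of_iso (homologyShiftIso X a i (a + i) rfl).symm (hX _ _ (by lia))
  zero' X Y f hX hY := by
    let e₁ := Q.objObjPreimageIso X
    let e₂ := Q.objObjPreimageIso Y
    have := hom_Q_obj_eq_zero Z (e₁.hom ≫ f ≫ e₂.inv)
      ((homologyLE Z 0).prop_of_iso e₁.symm hX) ((homologyGE Z 1).prop_of_iso e₂.symm hY)
    rwa [Preadditive.IsIso.comp_left_eq_zero, Preadditive.IsIso.comp_right_eq_zero] at this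
  le_zero_le X hX i j h := hX i j (by lia)
  ge_one_le X hX i j h := hX i j (by lia)
  exists_triangle_zero_one X := by
    let K := Q.objPreimage X
    let e : Q.obj K ≅ X := Q.objObjPreimageIso X
    let T := triangleOfSES (subcomplexShortComplex_shortExact Z K)
    refine ⟨_, _, homologyLE_subcomplex Z K, homologyGE_cokernel Z K,
      T.mor₁ ≫ e.hom, e.inv ≫ T.mor₂, T.mor₃,
      Pretriangulated.isomorphic_distinguished _ (triangleOfSES_distinguished
        (subcomplexShortComplex_shortExact Z K)) _
        (Pretriangulated.Triangle.isoMk _ _ (Iso.refl _) e.symm (Iso.refl _) ?_ ?_ ?_)⟩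
    · exact (Category.assoc _ _ _).trans ((T.mor₁ ≫= e.hom_inv_id).trans
        ((Category.comp_id _).trans (Category.id_comp _).symm))
    · change (e.inv ≫ T.mor₂) ≫ 𝟙 T.obj₃ = e.inv ≫ T.mor₂
      simp
    · change T.mor₃ ≫ (𝟙 T.obj₁)⟦(1 : ℤ)⟧' = 𝟙 T.obj₃ ≫ T.mor₃
      simp

end Derived

end IsDegreeVanishing

end DegreeVanishing

/-! ### Restriction to triangulated subcategories -/

namespace IsDegreeVanishing

section Derived

variable {A : Type*} [Category* A] [Abelian A] (Z : ℤ → ObjectProperty A) [IsDegreeVanishing Z]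
  [HasDerivedCategory.{w} A]

open DerivedCategory

/-- A triangulated subcategory inherits the `t`-structure if it contains the upper truncations
of its objects. -/
lemma hasInducedTStructure (P : ObjectProperty (DerivedCategory A)) [P.IsTriangulated]
    [P.IsClosedUnderIsomorphisms]
    (h : ∀ T : Pretriangulated.Triangle (DerivedCategory A), T ∈ distTriang _ →
      homologyLE Z 0 T.obj₁ → homologyGE Z 1 T.obj₃ → P T.obj₂ → P T.obj₃) :
    P.HasInducedTStructure (tStructure Z) where
  exists_triangle_zero_one X hX := by
    obtain ⟨U, V, hU, hV, f, g, δ, hT⟩ := (tStructure Z).exists_triangle_zero_one X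
    have h₃ := h _ hT hU hV hX
    exact ⟨U, V, ⟨hU⟩, ⟨hV⟩, f, g, δ, hT,
      P.le_isoClosure _ (P.ext_of_isTriangulatedClosed₁ _ hT hX h₃), P.le_isoClosure _ h₃⟩

lemma bounded_of_triangle (T : Pretriangulated.Triangle (DerivedCategory A))
    (hT : T ∈ distTriang _) (h₁ : homologyLE Z 0 T.obj₁) (h₃ : homologyGE Z 1 T.obj₃)
    (h₂ : TStructure.t.bounded T.obj₂) : TStructure.t.bounded T.obj₃ := by
  have hepi := epi_homologyMap_mor₂ hT 0 h₁ h₃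
  obtain ⟨⟨a, ha⟩, b, hb⟩ := h₂
  refine ⟨⟨a, (isGE_iff _ _).2 fun i hi => ?_⟩, b, (isLE_iff _ _).2 fun i hi => ?_⟩
  · have := hepi i
    exact IsZero.of_epi ((homologyFunctor A i).map T.mor₂) ((isGE_iff _ _).1 ha i hi)
  · have := hepi i
    exact IsZero.of_epi ((homologyFunctor A i).map T.mor₂) ((isLE_iff _ _).1 hb i hi)

instance : (TStructure.t : TStructure (DerivedCategory A)).bounded.HasInducedTStructure
    (tStructure Z) :=
  hasInducedTStructure Z _ (bounded_of_triangle Z)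

end Derived

end IsDegreeVanishing

/-! ### Degree truncation of graded modules -/

namespace GrMod

section Vanishing

variable {R : Type u} [Ring R] {σ : Type*} [SetLike σ R] (𝓡 : ℤ → σ)

/-- The graded modules whose component of degree `j` vanishes. -/
def vanishing (j : ℤ) : ObjectProperty (GrMod 𝓡) := fun M => M.piece j = ⊥

variable {𝓡}

/-- Serves twice: with `π = 0` for subobjects, and with `π` a truncation for its categorical kernel,
without identifying that kernel. -/
lemma vanishing_of_mono {L M N : GrMod 𝓡} (ι : L ⟶ M) [Mono ι] (π : M ⟶ N) (w : ι ≫ π = 0)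
    (j : ℤ) (h : ∀ m ∈ M.piece j, π.lin m = 0 → m = 0) : vanishing 𝓡 j L := by
  rw [vanishing, eq_bot_iff]
  intro x hx
  apply injective_of_mono ι
  rw [map_zero]
  exact h _ (ι.map_mem hx) (lin_apply_eq_zero w x)

instance (j : ℤ) : (vanishing 𝓡 j).IsClosedUnderSubobjects where
  prop_of_mono {M N} f _ hN := vanishing_of_mono f (0 : N ⟶ N) comp_zero j fun m hm _ => by
    rw [show N.piece j = ⊥ from hN] at hm
    exact hm

instance (j : ℤ) : (vanishing 𝓡 j).IsClosedUnderQuotients where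
  prop_of_epi {M N} f _ hM := by
    rw [vanishing, eq_bot_iff]
    intro n hn
    obtain ⟨m, hm, rfl⟩ := exists_mem_of_surjective f (surjective_of_epi f) hn
    rw [show M.piece j = ⊥ from hM] at hm
    rw [show m = 0 from hm, map_zero]
    exact zero_mem _

lemma isZero_of_vanishing (M : GrMod 𝓡) (h : ∀ j, vanishing 𝓡 j M) : IsZero M := by
  rw [IsZero.iff_id_eq_zero]
  ext m
  obtain ⟨s, hs⟩ := M.exists_sum_proj m
  rw [← hs, map_sum, map_sum]
  refine Finset.sum_congr rfl fun j _ => ?_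
  have := M.proj_mem j m
  rw [show M.piece j = ⊥ from h j] at this
  rw [show M.proj j m = 0 from this, map_zero, map_zero]

end Vanishing

section TruncLE

variable {R : Type u} [Ring R] {σ : Type*} [SetLike σ R] [AddSubmonoidClass σ R] {𝓡 : ℤ → σ}
  [GradedRing 𝓡] (h𝓡 : IsNegativelyGraded 𝓡)

include h𝓡 in
lemma proj_smul_eq_zero {M : GrMod 𝓡} {a : ℤ} {m : M} (hm : ∀ j, a < j → M.proj j m = 0)
    (r : R) (j : ℤ) (hj : a < j) : M.proj j (MulOpposite.op r • m) = 0 := by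
  obtain ⟨s, hs⟩ := M.exists_sum_proj m
  rw [← hs, Finset.smul_sum, map_sum]
  refine Finset.sum_eq_zero fun i _ => ?_
  rw [proj_smul (M.proj_mem i m)]
  rcases le_or_gt i a with hi | hi
  · rw [h𝓡 (j - i) (by lia) _ (decompose 𝓡 r (j - i)).2, MulOpposite.op_zero, zero_smul]
  · rw [hm i hi, smul_zero]

/-- The submodule of elements all of whose homogeneous components have degree `≤ a`. -/
def truncLE (M : GrMod 𝓡) (a : ℤ) : Submodule Rᵐᵒᵖ M where
  carrier := {m | ∀ j, a < j → M.proj j m = 0}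
  zero_mem' j _ := map_zero _
  add_mem' hx hy j hj := by rw [map_add, hx j hj, hy j hj, add_zero]
  smul_mem' c _ hx j hj := proj_smul_eq_zero h𝓡 hx c.unop j hj

lemma mem_truncLE_of_mem_piece {M : GrMod 𝓡} {i a : ℤ} (h : i ≤ a) {m : M} (hm : m ∈ M.piece i) :
    m ∈ M.truncLE h𝓡 a :=
  fun _ hj => M.proj_ne hm (by lia)

lemma eq_zero_of_mem_truncLE {M : GrMod 𝓡} {i a : ℤ} (h : a < i) {m : M} (hm : m ∈ M.piece i)
    (hm' : m ∈ M.truncLE h𝓡 a) : m = 0 := by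
  rw [← M.proj_same hm]
  exact hm' i h

lemma truncLE_homogeneous (M : GrMod 𝓡) (a i : ℤ) (m : M) (hm : m ∈ M.truncLE h𝓡 a) :
    M.proj i m ∈ M.truncLE h𝓡 a := by
  intro j hj
  by_cases h : i = j
  · subst h
    rw [hm i hj, map_zero]
  · exact M.proj_ne (M.proj_mem i m) h

/-- The quotient of a graded module by its elements of degree `≤ a`. -/
noncomputable abbrev quotTruncLE (M : GrMod 𝓡) (a : ℤ) : GrMod 𝓡 :=
  M.quotient (M.truncLE h𝓡 a) (truncLE_homogeneous h𝓡 M a)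

/-- The projection to the quotient by the elements of degree `≤ a`. -/
noncomputable def quotTruncLEπ (M : GrMod 𝓡) (a : ℤ) : M ⟶ M.quotTruncLE h𝓡 a where
  lin := (M.truncLE h𝓡 a).mkQ
  map_mem h := ⟨_, h, rfl⟩

lemma vanishing_quotTruncLE (M : GrMod 𝓡) (a j : ℤ) (h : j ≤ a) :
    vanishing 𝓡 j (M.quotTruncLE h𝓡 a) := by
  rw [vanishing, eq_bot_iff]
  rintro _ ⟨m, hm, rfl⟩
  exact (Submodule.Quotient.mk_eq_zero _).2 (mem_truncLE_of_mem_piece h𝓡 h hm)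

lemma eq_zero_of_quotTruncLEπ {M : GrMod 𝓡} {a j : ℤ} (h : a < j) (m : M) (hm : m ∈ M.piece j)
    (h0 : (M.quotTruncLEπ h𝓡 a).lin m = 0) : m = 0 :=
  eq_zero_of_mem_truncLE h𝓡 h hm ((Submodule.Quotient.mk_eq_zero _).1 h0)

include h𝓡 in
lemma isDegreeVanishing : IsDegreeVanishing (vanishing 𝓡) where
  isClosedUnderSubobjects _ := inferInstance
  isClosedUnderQuotients _ := inferInstance
  isZero := isZero_of_vanishing
  exists_trunc M a := ⟨_, M.quotTruncLEπ h𝓡 a, M.vanishing_quotTruncLE h𝓡 a, fun j h =>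
    vanishing_of_mono (kernel.ι _) _ (kernel.condition _) j (eq_zero_of_quotTruncLEπ h𝓡 h)⟩

/-- The action of `R` on an element of a right module. -/
def smulMap (M : GrMod 𝓡) (x : M) : R →ₗ[Rᵐᵒᵖ] M where
  toFun r := MulOpposite.op r • x
  map_add' r s := by rw [MulOpposite.op_add, add_smul]
  map_smul' c r := by
    induction c using MulOpposite.rec' with
    | _ s => exact mul_smul (MulOpposite.op s) (MulOpposite.op r) x

lemma smulMap_mem_truncLE {M : GrMod 𝓡} {x : M} {d : ℤ} (hx : x ∈ M.piece d) (a : ℤ) (r : R)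
    (hr : r ∈ rightIdealLE 𝓡 h𝓡 (a - d)) : M.smulMap x r ∈ M.truncLE h𝓡 a := by
  intro j hj
  change M.proj j (MulOpposite.op r • x) = 0
  rw [proj_smul hx, hr (j - d) (by lia), MulOpposite.op_zero, zero_smul]

set_option linter.unusedSectionVars false in
lemma exists_eq_sum_smulMap {M : GrMod 𝓡} {n : ℕ} {x : Fin n → M}
    (hx : Submodule.span Rᵐᵒᵖ (Set.range x) = ⊤) (m : M) :
    ∃ c : Fin n → R, ∑ k, M.smulMap (x k) (c k) = m := by
  have hm : m ∈ Submodule.span Rᵐᵒᵖ (Set.range x) := hx ▸ Submodule.mem_top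
  obtain ⟨c, rfl⟩ := (Submodule.mem_span_range_iff_exists_fun _).1 hm
  exact ⟨fun k => (c k).unop, rfl⟩

/-- If `m = ∑ x_k c_k`, its component of degree `j` is `∑ x_k (c_k)_{j - d_k}`, and `j ≤ a` means `j
- d_k ≤ a - d_k`. This reduces finiteness of truncations to the ideals `R_{≤ i}`. -/
lemma truncLE_eq_iSup {M : GrMod 𝓡} {n : ℕ} {d : Fin n → ℤ} {x : Fin n → M}
    (hd : ∀ k, x k ∈ M.piece (d k)) (hx : Submodule.span Rᵐᵒᵖ (Set.range x) = ⊤) (a : ℤ) :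
    M.truncLE h𝓡 a = ⨆ k, (rightIdealLE 𝓡 h𝓡 (a - d k)).map (M.smulMap (x k)) := by
  apply le_antisymm
  · intro m hm
    obtain ⟨s, hs⟩ := M.exists_sum_proj m
    rw [← hs]
    refine sum_mem fun j _ => ?_
    rcases le_or_gt j a with hj | hj
    · obtain ⟨c, hc⟩ := exists_eq_sum_smulMap hx m
      have : M.proj j m = ∑ k, M.smulMap (x k) (decompose 𝓡 (c k) (j - d k) : R) := by
        rw [← hc, map_sum]
        exact Finset.sum_congr rfl fun k _ => proj_smul (hd k) j (c k)
      rw [this]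
      refine sum_mem fun k _ => Submodule.mem_iSup_of_mem k ⟨_, fun i hi => ?_, rfl⟩
      rw [decompose_coe, of_eq_of_ne _ _ _ (by lia), ZeroMemClass.coe_zero]
    · rw [hm j hj]
      exact zero_mem _
  · refine iSup_le fun k => ?_
    rintro _ ⟨r, hr, rfl⟩
    exact smulMap_mem_truncLE h𝓡 (hd k) a r hr

lemma rightIdealLE_eq_top {i : ℤ} (hi : 0 ≤ i) : rightIdealLE 𝓡 h𝓡 i = ⊤ := by
  rw [eq_top_iff]
  exact fun r _ j hj => h𝓡 j (by lia) _ (decompose 𝓡 r j).2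

end TruncLE

/-! ### Truncations of finitely presented modules -/

section FinPres

variable {R : Type u} [Ring R] {𝓡 : ℤ → AddSubgroup R} [GradedRing 𝓡]
  (h𝓡 : IsNegativelyGraded 𝓡)
  (hR : ∀ i : ℤ, i ≤ 0 → Module.FinitePresentation Rᵐᵒᵖ (R ⧸ rightIdealLE 𝓡 h𝓡 i))

include hR

lemma rightIdealLE_fg (i : ℤ) : (rightIdealLE 𝓡 h𝓡 i).FG := by
  -- The assumption (R3) covers `i ≤ 0`; for `i ≥ 0` the ideal is all of `R`.
  rcases le_total i 0 with hi | hi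
  · have := hR i hi
    have := Module.FinitePresentation.fg_ker (rightIdealLE 𝓡 h𝓡 i).mkQ
      (Submodule.mkQ_surjective _)
    rwa [Submodule.ker_mkQ] at this
  · rw [rightIdealLE_eq_top h𝓡 hi]
    exact Module.Finite.fg_top

lemma finPres_quotTruncLE (M : GrMod 𝓡) (hM : finPres 𝓡 M) (a : ℤ) :
    finPres 𝓡 (M.quotTruncLE h𝓡 a) := by
  have : Module.FinitePresentation Rᵐᵒᵖ M := hM
  obtain ⟨n, d, x, hd, hx⟩ := M.exists_homogeneous_generators
  have : Module.FinitePresentation Rᵐᵒᵖ (M ⧸ M.truncLE h𝓡 a) :=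
    Module.finitePresentation_of_surjective (M.truncLE h𝓡 a).mkQ (Submodule.mkQ_surjective _) (by
      rw [Submodule.ker_mkQ, truncLE_eq_iSup h𝓡 hd hx]
      exact Submodule.fg_iSup _ fun k => (rightIdealLE_fg h𝓡 hR _).map _)
  exact this

lemma isDegreeVanishing_finPres [IsGradedCoherent 𝓡] :
    IsDegreeVanishing fun j => (vanishing 𝓡 j).inverseImage (finPres 𝓡).ι := by
  have : (finPres 𝓡).ι.PreservesMonomorphisms :=
    (finPres 𝓡).preservesMonomorphisms_ι_of_isNormalEpiCategory
  have : (finPres 𝓡).ι.PreservesEpimorphisms :=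
    (finPres 𝓡).preservesEpimorphisms_ι_of_isNormalMonoCategory
  exact
  { isClosedUnderSubobjects _ := inferInstance
    isClosedUnderQuotients _ := inferInstance
    isZero M h := by
      rw [IsZero.iff_id_eq_zero]
      exact (finPres 𝓡).ι.map_injective ((isZero_of_vanishing M.obj h).eq_of_src _ _)
    exists_trunc M a := by
      let N : FPGrMod 𝓡 := ⟨_, finPres_quotTruncLE h𝓡 hR M.obj M.property a⟩
      let π : M ⟶ N := (finPres 𝓡).homMk (M.obj.quotTruncLEπ h𝓡 a)
      refine ⟨N, π, M.obj.vanishing_quotTruncLE h𝓡 a, fun j h => ?_⟩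
      have w : (finPres 𝓡).ι.map (kernel.ι π) ≫ M.obj.quotTruncLEπ h𝓡 a = 0 :=
        congrArg (fun f => f.hom) (kernel.condition π)
      exact vanishing_of_mono _ _ w j (eq_zero_of_quotTruncLEπ h𝓡 h) }

end FinPres

end GrMod

/-! ### Dévissage for bounded complexes with homology in a given class -/

section Bounded

variable {A : Type*} [Category* A] [Abelian A] [HasDerivedCategory.{w} A]

open DerivedCategory

namespace DerivedCategory

/-- The bounded objects of the derived category whose homology satisfies `P`. -/
def boundedHomology (P : ObjectProperty A) : ObjectProperty (DerivedCategory A) :=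
  fun X => TStructure.t.bounded X ∧ ∀ i, P ((homologyFunctor A i).obj X)

section

variable (P : ObjectProperty A) [P.IsClosedUnderIsomorphisms]

lemma boundedHomology_singleFunctor [P.ContainsZero] (M : A) (hM : P M) :
    boundedHomology P ((singleFunctor A 0).obj M) := by
  refine ⟨⟨⟨0, inferInstance⟩, 0, inferInstance⟩, fun i => ?_⟩
  rcases lt_trichotomy i 0 with h | rfl | h
  · exact P.prop_of_isZero (isZero_of_isGE _ 0 i h)
  · exact P.prop_of_iso ((homologyFunctorFactors A 0).app _ ≪≫
      (HomologicalComplex.homologyFunctorSingleIso A (.up ℤ) 0).app M).symm hM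
  · exact P.prop_of_isZero (isZero_of_isLE _ 0 i h)

lemma prop_of_singleFunctorIso {X : DerivedCategory A} {n : ℤ} {M : A}
    (e : X ≅ (singleFunctor A n).obj M) (h : P ((homologyFunctor A n).obj X)) : P M :=
  P.prop_of_iso ((homologyFunctor A n).mapIso e ≪≫ (homologyFunctorFactors A n).app _ ≪≫
      (HomologicalComplex.homologyFunctorSingleIso A (.up ℤ) n).app M) h

end

variable (P : ObjectProperty A) [P.IsClosedUnderSubobjects] [P.IsClosedUnderQuotients]

instance : (boundedHomology P).IsStableUnderRetracts where
  of_retract {X Y} r h := by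
    obtain ⟨⟨⟨a, ha⟩, b, hb⟩, hP⟩ := h
    have hr : ∀ i, Mono ((homologyFunctor A i).map r.i) := fun i =>
      (SplitMono.mk ((homologyFunctor A i).map r.r)
        (by
        rw [← Functor.map_comp, r.retract, CategoryTheory.Functor.map_id])).mono
    refine ⟨⟨⟨a, (isGE_iff _ _).2 fun i hi => ?_⟩, b, (isLE_iff _ _).2 fun i hi => ?_⟩,
      fun i => ?_⟩
    · have := hr i
      exact IsZero.of_mono ((homologyFunctor A i).map r.i) ((isGE_iff _ _).1 ha i hi)
    · have := hr i
      exact IsZero.of_mono ((homologyFunctor A i).map r.i) ((isLE_iff _ _).1 hb i hi)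
    · have := hr i
      exact P.prop_of_mono ((homologyFunctor A i).map r.i) (hP i)

lemma boundedHomology_isTriangulated [P.ContainsZero]
    (hP : ∀ S : ShortComplex A, S.Exact → P S.X₁ → P S.X₃ → P S.X₂) :
    (boundedHomology P).IsTriangulated := by
  have hz : ∀ M : A, IsZero M → P M := fun M hM => P.prop_of_isZero hM
  have : (boundedHomology P).IsStableUnderShift ℤ :=
    ⟨fun n => ⟨fun X hX => ⟨(TStructure.t : TStructure (DerivedCategory A)).bounded.le_shift n _
      hX.1, fun i => P.prop_of_iso
        (IsDegreeVanishing.homologyShiftIso X n i (n + i) rfl).symm (hX.2 _)⟩⟩⟩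
  have : (boundedHomology P).ContainsZero := by
    obtain ⟨X, hX, hX'⟩ := (inferInstance :
      (TStructure.t : TStructure (DerivedCategory A)).bounded.ContainsZero)
    exact ⟨X, hX, hX', fun i => hz _ ((homologyFunctor A i).map_isZero hX)⟩
  have : (boundedHomology P).IsTriangulatedClosed₂ := .mk' fun T hT h₁ h₃ =>
    ⟨(TStructure.t : TStructure (DerivedCategory A)).bounded.ext_of_isTriangulatedClosed₂
      T hT h₁.1 h₃.1, fun i => hP _ (HomologySequence.exact₂ T hT i) (h₁.2 i) (h₃.2 i)⟩
  exact { }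

/-- A triangulated subcategory which contains the objects satisfying `P` in degree `0` contains
all bounded complexes with homology satisfying `P`. -/
lemma boundedHomology_le [P.ContainsZero] (T : ObjectProperty (DerivedCategory A)) [T.IsTriangulated]
    [T.IsClosedUnderIsomorphisms] (h : ∀ M, P M → T ((singleFunctor A 0).obj M)) :
    boundedHomology P ≤ T := by
  have h₀ : ∀ (a : ℤ) (X : DerivedCategory A), X.IsGE a → X.IsLE a →
      (∀ i, P ((homologyFunctor A i).obj X)) → T X := by
    intro a X _ _ hX
    obtain ⟨M, ⟨e⟩⟩ := X.exists_iso_singleFunctor_obj_of_isGE_of_isLE a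
    have hM := h M (prop_of_singleFunctorIso P e (hX a))
    exact T.prop_of_iso (((singleFunctors A).shiftIso (-a) a 0 (by lia)).app M ≪≫ e.symm)
      (T.le_shift (-a) _ hM)
  have h₁ : ∀ (n : ℕ) (a : ℤ) (X : DerivedCategory A), X.IsGE a → X.IsLE (a + n) →
      (∀ i, P ((homologyFunctor A i).obj X)) → T X := by
    intro n
    induction n with
    | zero =>
      intro a X hXa hXb hX
      exact h₀ a X hXa (by simpa using hXb) hX
    | succ n ih =>
      intro a X _ _ hX
      -- Split off the lowest homology with the canonical `t`-structure. Each homology object of `U`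
      -- or `V` is zero or a subobject, respectively a quotient, of one of `X`, so it still
      -- satisfies `P`.
      obtain ⟨U, V, hU, hV, f, g, δ, hT⟩ := TStructure.t.exists_triangle X a (a + 1) rfl
      have hU : U.IsLE a := ⟨hU⟩
      have hV : V.IsGE (a + 1) := ⟨hV⟩
      have hf : ∀ i, i ≤ a → Mono ((homologyFunctor A i).map f) := fun i hi =>
        (HomologySequence.mono_homologyMap_mor₁_iff _ hT (i - 1) i (by lia)).2
          ((isZero_of_isGE V (a + 1) (i - 1) (by lia)).eq_of_src _ _)
      have hg : ∀ i, a ≤ i → Epi ((homologyFunctor A i).map g) := fun i hi =>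
        (HomologySequence.epi_homologyMap_mor₂_iff _ hT i (i + 1) rfl).2
          ((isZero_of_isLE U a (i + 1) (by lia)).eq_of_tgt _ _)
      refine T.ext_of_isTriangulatedClosed₂ _ hT (h₀ a U ?_ hU fun i => ?_)
        (ih (a + 1) V hV ?_ fun i => ?_)
      · refine (isGE_iff _ _).2 fun i hi => ?_
        have := hf i hi.le
        exact IsZero.of_mono ((homologyFunctor A i).map f) (isZero_of_isGE X a i hi)
      · rcases le_or_gt i a with hi | hi
        · have := hf i hi
          exact P.prop_of_mono ((homologyFunctor A i).map f) (hX i)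
        · exact P.prop_of_isZero (isZero_of_isLE U a i hi)
      · refine (isLE_iff _ _).2 fun i hi => ?_
        have := hg i (by lia)
        exact IsZero.of_epi ((homologyFunctor A i).map g)
          (isZero_of_isLE X (a + (n + 1 : ℕ)) i (by push_cast; lia))
      · rcases le_or_gt a i with hi | hi
        · have := hg i hi
          exact P.prop_of_epi ((homologyFunctor A i).map g) (hX i)
        · exact P.prop_of_isZero (isZero_of_isGE V (a + 1) i (by lia))
  rintro X ⟨⟨⟨a, ha⟩, b, hb⟩, hP⟩
  -- The bound `b ≤ a + (b - a).toNat` also holds when `b < a`, where `toNat` gives `0`.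
  exact h₁ (b - a).toNat a X ha (TStructure.t.isLE_of_le X b _) hP

end DerivedCategory

end Bounded

/-! ### Graded modules with truncations of finite length -/

namespace GrMod

section Exact

variable {R : Type u} [Ring R] {σ : Type*} [SetLike σ R] {𝓡 : ℤ → σ}

lemma exists_lin_eq_of_exact {S : ShortComplex (GrMod 𝓡)} (hS : S.Exact) {x : S.X₂}
    (hx : S.g.lin x = 0) : ∃ y, S.f.lin y = x := by
  have h : kerι S.g ≫ cokerπ S.f = 0 := by
    rw [← kernel.lift_ι S.g _ (kerι_comp S.g), ← cokernel.π_desc S.f _ (comp_cokerπ S.f),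
      Category.assoc, reassoc_of% (S.exact_iff_kernel_ι_comp_cokernel_π_zero.1 hS), zero_comp,
      comp_zero]
  exact (Submodule.Quotient.mk_eq_zero _).1
    (lin_apply_eq_zero h (⟨x, hx⟩ : LinearMap.ker S.g.lin))

end Exact

section FiniteLength

variable {R : Type u} [Ring R] {σ : Type*} [SetLike σ R]

/-- Graded modules of finite length. -/
def finLength (𝓡 : ℤ → σ) : ObjectProperty (GrMod 𝓡) := fun M => IsFiniteLength Rᵐᵒᵖ M

variable {𝓡 : ℤ → σ}

instance : (finLength 𝓡).IsClosedUnderSubobjects where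
  prop_of_mono f _ h := h.of_injective (injective_of_mono f)

instance : (finLength 𝓡).IsClosedUnderQuotients where
  prop_of_epi f _ h := h.of_surjective (surjective_of_epi f)

instance : (finLength 𝓡).ContainsZero :=
  have : Subsingleton (zeroObj 𝓡) := inferInstanceAs (Subsingleton PUnit.{u + 1})
  ⟨⟨zeroObj 𝓡, isZero_zeroObj 𝓡, .of_subsingleton⟩⟩

variable [AddSubmonoidClass σ R] [GradedRing 𝓡] (h𝓡 : IsNegativelyGraded 𝓡)

/-- The graded modules whose components of degree `> a` make up a module of finite length,
for each `a`. -/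
def finLengthTrunc : ObjectProperty (GrMod 𝓡) :=
  fun M => ∀ a : ℤ, IsFiniteLength Rᵐᵒᵖ (M ⧸ M.truncLE h𝓡 a)

lemma truncLE_le_comap {M N : GrMod 𝓡} (f : M ⟶ N) (a : ℤ) :
    M.truncLE h𝓡 a ≤ (N.truncLE h𝓡 a).comap f.lin := fun m hm j hj => by
  rw [← lin_proj, hm j hj, map_zero]

/-- The map induced on the quotients by the elements of degree `≤ a`. -/
def quotTruncLEMap {M N : GrMod 𝓡} (f : M ⟶ N) (a : ℤ) :
    M ⧸ M.truncLE h𝓡 a →ₗ[Rᵐᵒᵖ] N ⧸ N.truncLE h𝓡 a :=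
  Submodule.mapQ _ _ f.lin (truncLE_le_comap h𝓡 f a)

instance : (finLengthTrunc h𝓡).IsClosedUnderSubobjects where
  prop_of_mono {M N} f _ h a := by
    refine IsFiniteLength.of_injective (h a) (f := quotTruncLEMap h𝓡 f a) ?_
    rw [injective_iff_map_eq_zero]
    intro x hx
    obtain ⟨m, rfl⟩ := Submodule.mkQ_surjective _ x
    have hm : f.lin m ∈ N.truncLE h𝓡 a := (Submodule.Quotient.mk_eq_zero _).1 hx
    refine (Submodule.Quotient.mk_eq_zero _).2 fun j hj => injective_of_mono f ?_
    rw [lin_proj, hm j hj, map_zero]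

instance : (finLengthTrunc h𝓡).IsClosedUnderQuotients where
  prop_of_epi {M N} f _ h a := by
    refine IsFiniteLength.of_surjective (h a) (f := quotTruncLEMap h𝓡 f a) ?_
    intro x
    obtain ⟨n, rfl⟩ := Submodule.mkQ_surjective _ x
    obtain ⟨m, rfl⟩ := surjective_of_epi f n
    exact ⟨Submodule.mkQ _ m, rfl⟩

instance : (finLengthTrunc h𝓡).ContainsZero :=
  ⟨⟨zeroObj 𝓡, isZero_zeroObj 𝓡, fun _ => IsFiniteLength.of_surjective
    ((finLength 𝓡).prop_of_isZero (isZero_zeroObj 𝓡)) (Submodule.mkQ_surjective _)⟩⟩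

/-- Taking components is exact, so the quotients by degrees `≤ a` remain exact in the middle, and
finite length passes to the middle term. -/
lemma finLengthTrunc_of_exact (S : ShortComplex (GrMod 𝓡)) (hS : S.Exact)
    (h₁ : finLengthTrunc h𝓡 S.X₁) (h₃ : finLengthTrunc h𝓡 S.X₃) : finLengthTrunc h𝓡 S.X₂ := by
  intro a
  obtain ⟨_, _⟩ := isFiniteLength_iff_isNoetherian_isArtinian.1 (h₁ a)
  obtain ⟨_, _⟩ := isFiniteLength_iff_isNoetherian_isArtinian.1 (h₃ a)
  have h : LinearMap.range (quotTruncLEMap h𝓡 S.f a) =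
      LinearMap.ker (quotTruncLEMap h𝓡 S.g a) := by
    apply le_antisymm
    · rintro _ ⟨x, rfl⟩
      obtain ⟨m, rfl⟩ := Submodule.mkQ_surjective _ x
      exact congrArg (Submodule.mkQ _) (lin_apply_eq_zero S.zero m)
    · intro x hx
      obtain ⟨m, rfl⟩ := Submodule.mkQ_surjective _ x
      have hm : S.g.lin m ∈ S.X₃.truncLE h𝓡 a := (Submodule.Quotient.mk_eq_zero _).1 hx
      -- Components of `m` of degree `≤ a` die in the quotient; those of degree `> a` are killed by
      -- `S.g` and lift through `S.f`.
      obtain ⟨s, hs⟩ := S.X₂.exists_sum_proj m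
      rw [← hs, map_sum]
      refine sum_mem fun j _ => ?_
      rcases le_or_gt j a with hj | hj
      · rw [show Submodule.mkQ _ (S.X₂.proj j m) = 0 from (Submodule.Quotient.mk_eq_zero _).2
          (mem_truncLE_of_mem_piece h𝓡 hj (S.X₂.proj_mem j m))]
        exact zero_mem _
      · obtain ⟨y, hy⟩ := exists_lin_eq_of_exact hS (x := S.X₂.proj j m)
          (by rw [lin_proj, hm j hj])
        exact ⟨Submodule.mkQ _ y, congrArg (Submodule.mkQ _) hy⟩
  exact isFiniteLength_iff_isNoetherian_isArtinian.2
    ⟨isNoetherian_of_range_eq_ker _ _ h, isArtinian_of_range_eq_ker _ _ h⟩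

/-- A quotient in degrees `> a` of a graded module has finite length if the components of degree
`> a` of this module make up a module of finite length. -/
lemma finLength_of_epi {M N : GrMod 𝓡} (f : M ⟶ N) [Epi f] (hM : finLengthTrunc h𝓡 M) (a : ℤ)
    (hN : ∀ j, j ≤ a → vanishing 𝓡 j N) : finLength 𝓡 N := by
  have h : M.truncLE h𝓡 a ≤ LinearMap.ker f.lin := by
    intro m hm
    obtain ⟨s, hs⟩ := M.exists_sum_proj m
    rw [← hs]
    refine sum_mem fun j _ => ?_
    rcases le_or_gt j a with hj | hj
    · have := f.map_mem (M.proj_mem j m)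
      rw [show N.piece j = ⊥ from hN j hj] at this
      exact this
    · rw [hm j hj]
      exact zero_mem _
  refine IsFiniteLength.of_surjective (hM a) (f := Submodule.liftQ _ f.lin h) ?_
  intro n
  obtain ⟨m, rfl⟩ := surjective_of_epi f n
  exact ⟨Submodule.mkQ _ m, rfl⟩

end FiniteLength

/-! ### Finite length from finite-dimensional components -/

section FiniteDimensional

variable {k : Type v} [Field k] {R : Type u} [Ring R] [Algebra k R] {𝓡 : ℤ → Submodule k R}
  [GradedAlgebra 𝓡] (h𝓡 : IsNegativelyGraded 𝓡) (hR : ∀ i, Module.Finite k (𝓡 i))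

include hR

lemma finite_quotient_rightIdealLE (i : ℤ) : Module.Finite k (R ⧸ rightIdealLE 𝓡 h𝓡 i) := by
  let q : R →ₗ[k] R ⧸ rightIdealLE 𝓡 h𝓡 i := (rightIdealLE 𝓡 h𝓡 i).mkQ.restrictScalars k
  -- Only the degrees `i < j ≤ 0` matter: lower components lie in the ideal and positive ones are
  -- zero.
  let φ : (∀ j : Finset.Ioc i 0, 𝓡 j) →ₗ[k] R ⧸ rightIdealLE 𝓡 h𝓡 i :=
    ∑ j : Finset.Ioc i 0, q ∘ₗ (𝓡 j).subtype ∘ₗ LinearMap.proj j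
  refine Module.Finite.of_surjective φ ?_
  rw [← LinearMap.range_eq_top, eq_top_iff]
  rintro x -
  obtain ⟨r, rfl⟩ := Submodule.mkQ_surjective _ x
  have key : ∀ j (s : 𝓡 j), (rightIdealLE 𝓡 h𝓡 i).mkQ s ∈ LinearMap.range φ := by
    intro j s
    by_cases hj : j ∈ Finset.Ioc i 0
    · refine ⟨Pi.single ⟨j, hj⟩ s, ?_⟩
      rw [LinearMap.sum_apply, Finset.sum_eq_single ⟨j, hj⟩]
      · simp [q]
      · intro l _ hl
        simp [Pi.single_eq_of_ne hl]
      · simp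
    · have : (rightIdealLE 𝓡 h𝓡 i).mkQ s = 0 := by
        refine (Submodule.Quotient.mk_eq_zero _).2 fun l hl => ?_
        by_cases hlj : l = j
        · subst hlj
          rw [h𝓡 l (by simp at hj; lia) s s.2]
          simp
        · rw [decompose_coe, of_eq_of_ne _ _ _ hlj, ZeroMemClass.coe_zero]
      rw [this]
      exact zero_mem _
  classical
  rw [← sum_support_decompose 𝓡 r, map_sum]
  exact sum_mem fun j _ => key j _

lemma isFiniteLength_quotient_rightIdealLE (i : ℤ) :
    IsFiniteLength Rᵐᵒᵖ (R ⧸ rightIdealLE 𝓡 h𝓡 i) := by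
  have := finite_quotient_rightIdealLE h𝓡 hR i
  exact isFiniteLength_iff_isNoetherian_isArtinian.2
    ⟨isNoetherian_of_tower k inferInstance, isArtinian_of_tower k inferInstance⟩

/-- Homogeneous generators `x_l` of degree `d_l` make `M / M_{≤ a}` a quotient of the finite sum of
the modules `R / R_{≤ a - d_l}`. -/
lemma finLengthTrunc_of_finite (M : GrMod 𝓡) [Module.Finite Rᵐᵒᵖ M] : finLengthTrunc h𝓡 M := by
  intro a
  obtain ⟨n, d, x, hd, hx⟩ := M.exists_homogeneous_generators
  let ψ (l : Fin n) : R ⧸ rightIdealLE 𝓡 h𝓡 (a - d l) →ₗ[Rᵐᵒᵖ] M ⧸ M.truncLE h𝓡 a :=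
    Submodule.mapQ _ _ (M.smulMap (x l)) (smulMap_mem_truncLE h𝓡 (hd l) a)
  let φ : (∀ l, R ⧸ rightIdealLE 𝓡 h𝓡 (a - d l)) →ₗ[Rᵐᵒᵖ] M ⧸ M.truncLE h𝓡 a :=
    ∑ l, ψ l ∘ₗ LinearMap.proj l
  have hfl := fun l => isFiniteLength_iff_isNoetherian_isArtinian.1
    (isFiniteLength_quotient_rightIdealLE h𝓡 hR (a - d l))
  have := fun l => (hfl l).1
  have := fun l => (hfl l).2
  refine IsFiniteLength.of_surjective (f := φ)
    (isFiniteLength_iff_isNoetherian_isArtinian.2 ⟨inferInstance, inferInstance⟩) ?_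
  intro y
  obtain ⟨m, rfl⟩ := Submodule.mkQ_surjective _ y
  obtain ⟨c, rfl⟩ := exists_eq_sum_smulMap hx m
  refine ⟨fun l => Submodule.mkQ _ (c l), ?_⟩
  rw [map_sum, LinearMap.sum_apply]
  rfl

end FiniteDimensional

end GrMod

/-! ### Perfect complexes -/

section Perfect

variable {R : Type u} [Ring R] {σ : Type*} [SetLike σ R] {𝓡 : ℤ → σ}
  [HasDerivedCategory.{w} (GrMod 𝓡)]

instance : (perfect 𝓡).IsClosedUnderIsomorphisms := by
  unfold perfect
  infer_instance

lemma perfect_of_finProj {P : GrMod 𝓡} (hP : finProj 𝓡 P) :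
    perfect 𝓡 ((DerivedCategory.singleFunctor (GrMod 𝓡) 0).obj P) :=
  ObjectProperty.le_triangEnvelope _ _ (ObjectProperty.prop_map_obj _ _ hP)

lemma HasFiniteProjResolution.perfect {M : GrMod 𝓡} (hM : HasFiniteProjResolution 𝓡 M) :
    perfect 𝓡 ((DerivedCategory.singleFunctor (GrMod 𝓡) 0).obj M) := by
  induction hM with
  | of_finProj hP => exact perfect_of_finProj hP
  | of_shortExact hS h₂ _ h₁ =>
    exact ObjectProperty.ext_of_isTriangulatedClosed₃ _ _ hS.singleTriangle_distinguished h₁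
      (perfect_of_finProj h₂)

end Perfect

namespace GrMod

variable {k : Type v} [Field k] {R : Type u} [Ring R] [Algebra k R] {𝓡 : ℤ → Submodule k R}
  [GradedAlgebra 𝓡] [HasDerivedCategory.{w} (GrMod 𝓡)] (h𝓡 : IsNegativelyGraded 𝓡)

open DerivedCategory

/-- The right-hand side is thick and contains the generators. Finite generation could not replace
`finLengthTrunc` here, since `R` is not assumed noetherian and finite generation need not pass to
submodules. -/
lemma perfect_le_boundedHomology (hR : ∀ i, Module.Finite k (𝓡 i)) :
    perfect 𝓡 ≤ boundedHomology (finLengthTrunc h𝓡) := by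
  have := boundedHomology_isTriangulated (finLengthTrunc h𝓡) (finLengthTrunc_of_exact h𝓡)
  refine ObjectProperty.triangEnvelope_le_iff _ |>.2 ?_
  rintro X ⟨P, ⟨_, _⟩, ⟨e⟩⟩
  exact (boundedHomology (finLengthTrunc h𝓡)).prop_of_iso e
    (boundedHomology_singleFunctor _ P (finLengthTrunc_of_finite h𝓡 hR P))

lemma perfect_hasInducedTStructure (hR : ∀ i, Module.Finite k (𝓡 i))
    (hfl : ∀ M : GrMod 𝓡, IsFiniteLength Rᵐᵒᵖ M → HasFiniteProjResolution 𝓡 M) :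
    have := isDegreeVanishing h𝓡
    (perfect 𝓡).HasInducedTStructure (IsDegreeVanishing.tStructure (vanishing 𝓡)) := by
  have := isDegreeVanishing h𝓡
  refine IsDegreeVanishing.hasInducedTStructure _ _ fun T hT h₁ h₃ h₂ => ?_
  obtain ⟨hb, hH⟩ := perfect_le_boundedHomology h𝓡 hR _ h₂
  -- It suffices that the upper truncation is bounded with homology of finite length: `H^i` is a
  -- quotient of `H^i(X)` concentrated in degrees `> -i`.
  refine boundedHomology_le (finLength 𝓡) _ (fun M hM => (hfl M hM).perfect) _
    ⟨IsDegreeVanishing.bounded_of_triangle _ T hT h₁ h₃ hb, fun i => ?_⟩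
  have := IsDegreeVanishing.epi_homologyMap_mor₂ hT 0 h₁ h₃ i
  exact finLength_of_epi h𝓡 ((homologyFunctor _ i).map T.mor₂) (hH i) (-i)
    fun j hj => h₃ i j (by lia)

end GrMod

theorem theorem3p1 :
    (∀ (k : Type v) [Field k] (R : Type u) [Ring R] [Algebra k R] (𝓡 : ℤ → Submodule k R)
      [GradedAlgebra 𝓡] [HasDerivedCategory.{w} (GrMod 𝓡)],
      IsNegativelyGraded 𝓡 →
      (∀ i : ℤ, Module.Finite k (𝓡 i)) →
      (∀ M : GrMod 𝓡, IsFiniteLength Rᵐᵒᵖ M → HasFiniteProjResolution 𝓡 M) →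
      ∃ t : TStructure (PerfectDerivedCategory 𝓡),
        (∀ X : PerfectDerivedCategory 𝓡, t.le 0 X ↔ ∀ i : ℤ,
          ((DerivedCategory.homologyFunctor (GrMod 𝓡) i).obj X.obj).ConcentratedLE (-i)) ∧
        (∀ X : PerfectDerivedCategory 𝓡, t.ge 0 X ↔ ∀ i : ℤ,
          ((DerivedCategory.homologyFunctor (GrMod 𝓡) i).obj X.obj).ConcentratedGE (-i))) ∧
    (∀ (R : Type u) [Ring R] (𝓡 : ℤ → AddSubgroup R) [GradedRing 𝓡] [IsGradedCoherent 𝓡]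
      [HasDerivedCategory.{w} (FPGrMod 𝓡)] (hneg : IsNegativelyGraded 𝓡),
      (∀ i : ℤ, i ≤ 0 → Module.FinitePresentation Rᵐᵒᵖ (R ⧸ rightIdealLE 𝓡 hneg i)) →
      ∃ t : TStructure (DerivedCategory.Bounded (FPGrMod 𝓡)),
        (∀ X : DerivedCategory.Bounded (FPGrMod 𝓡), t.le 0 X ↔ ∀ i : ℤ,
          ((DerivedCategory.homologyFunctor (FPGrMod 𝓡) i).obj X.obj).obj.ConcentratedLE (-i)) ∧
        (∀ X : DerivedCategory.Bounded (FPGrMod 𝓡), t.ge 0 X ↔ ∀ i : ℤ,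
          ((DerivedCategory.homologyFunctor (FPGrMod 𝓡) i).obj X.obj).obj.ConcentratedGE (-i))) := by
  constructor
  · intro k _ R _ _ 𝓡 _ _ h𝓡 hR hfl
    have := GrMod.isDegreeVanishing h𝓡
    have := GrMod.perfect_hasInducedTStructure h𝓡 hR hfl
    refine ⟨(perfect 𝓡).tStructure (IsDegreeVanishing.tStructure (GrMod.vanishing 𝓡)), fun X => ?_,
      fun X => ?_⟩
    -- The aisle is defined with the bound `0 - i`; past this rewriting the two conditions agree
    -- definitionally.
    · exact forall₂_congr fun i j => by rw [zero_sub]; rfl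
    · exact forall₂_congr fun i j => by rw [zero_sub]; rfl
  · intro R _ 𝓡 _ _ _ h𝓡 hR
    have := GrMod.isDegreeVanishing_finPres h𝓡 hR
    refine ⟨ObjectProperty.tStructure _ (IsDegreeVanishing.tStructure
      fun j => (GrMod.vanishing 𝓡 j).inverseImage (GrMod.finPres 𝓡).ι), fun X => ?_, fun X => ?_⟩
    · exact forall₂_congr fun i j => by rw [zero_sub]; rfl
    · exact forall₂_congr fun i j => by rw [zero_sub]; rfl
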